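/- **Setting.** Let $\mathbf x_1,\dots,\mathbf x_n$ be independent square-integrable random vectors in $\mathbb R^p$, $\mathbf x_i=(X_{i1},\dots,X_{ip})^T$, with a common mean. For some $1\le k_0<n$ the vectors $\mathbf x_1,\dots,\mathbf x_{k_0}$ have covariance matrix $\Sigma_1=(\sigma_1(a,b))$ and $\mathbf x_{k_0+1},\dots,\mathbf x_n$ have covariance matrix $\Sigma_2=(\sigma_2(a,b))$, where $\Sigma_1\ne\Sigma_2$. Put $\bar X_a=\frac1n\sum_{i=1}^n X_{ia}$, $\dot X_{ia}=X_{ia}-\bar X_a$ and $Y_i(a,b)=\dot X_{ia}\dot X_{ib}$. For $1\le a\le b\le p$ let $$V_k(a,b)=\frac{1}{k(k-1)}\sum_{i\ne j\le k}Y_i(a,b)Y_j(a,b)+\frac{1}{(n-k)(n-k-1)}\sum_{i\ne j>k}Y_i(a,b)Y_j(a,b)-\frac{2}{k(n-k)}\sum_{i\le k<j}Y_i(a,b)Y_j(a,b),$$ $$D(a,b)=\frac1{n-3}\sum_{k=2}^{n-2}\frac{k(n-k)}{n}V_k(a,b).$$ For a (deterministic) threshold $\tau>0$ let $\mathcal D_\tau=\{(a,b):1\le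 a\le b\le p,\ D(a,b)>\tau\}$, $$U_n(k)=\frac1{n^4}\sum_{\substack{i,t=1\\ i\ne t}}^{k}\ \sum_{\substack{j,l=k+1\\ j\ne l}}^{n}\ \sum_{(a,b)\in\mathcal D_\tau}\bigl(Y_i(a,b)-Y_j(a,b)\bigr)\bigl(Y_t(a,b)-Y_l(a,b)\bigr),$$ and let $\hat k$ be any maximizer of $U_n$ over $\{1,\dots,n\}$ (ties are broken arbitrarily). **Assumptions.** (A1) For constants $C_1,C_2,M>0$: $\mathbb P(|X_{ia}|>t)\le C_1e^{-C_2t^2}$ for all $i,a$ and all $t>0$, and $\|\Sigma_1\|_{op}\le M$, $\|\Sigma_2\|_{op}\le M$ (spectral norm). (A2) With a constant $C>0$ there is $\lambda$ such that $|\sigma_1(a,b)-\sigma_2(a,b)|>\lambda$ for all $(a,b)$ with $\sigma_1(a,b)\ne\sigma_2(a,b)$, and $$\lambda\ \ge\ C\sqrt{\frac{\tau}{n}}\,\max\Bigl\{\frac{n^2}{(n-k_0)^2},\frac{n^2}{k_0^2}\Bigr\}.$$ (A3) (For sequences of models, $n\to\infty$, with $p,k_0,\tau,\Sigma_1,\Sigma_2$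 and the distributions depending on the model.) For some constant $c>0$: $p^2n=o(e^{c\tau})$, $p^2n=o(e^{cn^{1/4}\sqrt\tau})$ and $p^2n^2=o(e^{c\sqrt\tau})$. **Theorem 3.3.** For all $C_1,C_2,M>0$ there is a constant $C_0>0$, depending only on $C_1,C_2,M$, such that the following holds. 1. There is $c_6>0$, depending only on $C_1,C_2,M$, and for every $\epsilon>0$ there is $c_5>0$, depending only on $C_1,C_2,M,\epsilon$, such that whenever (A1) holds and (A2) holds with some $C\ge C_0$, $$\mathbb P\Bigl\{\Bigl|\tfrac{\hat k}{k_0}-1\Bigr|\ge\epsilon\Bigr\}\le c_5\,p^2n\bigl[e^{-c_6\tau}+n\,e^{-c_6\sqrt\tau}\bigr].$$ 2. For every sequence of models with $n\to\infty$ that satisfies (A1) with the constants $C_1,C_2,M$, (A2) with a constant $C\ge C_0$, and (A3), $\hat k/k_0\to1$ in probability, i.e. $\mathbb P\{|\hat k/k_0-1|\ge\epsilon\}\to0$ for every $\epsilon>0$. -/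

import Mathlib

open MeasureTheory ProbabilityTheory Filter Topology Asymptotics

universe u

noncomputable section

namespace CovChangePoint

/-! Statistics of a data set `x 0, …, x (n-1)` of `n` observations in `ℝᵖ`. Observations are indexed
by `Fin n`, so the observations that a 1-based numbering calls `1, …, k` are those with `i.val < k`,
and `k+1, …, n` are those with `k ≤ i.val`. -/

/-- The first `k` observations. -/
def firstIdx (n k : ℕ) : Finset (Fin n) := Finset.univ.filter (fun i => i.val < k)

/-- The observations after the first `k`. -/
def lastIdx (n k : ℕ) : Finset (Fin n) := Finset.univ.filter (fun i => k ≤ i.val)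

/-- The `a`-th coordinate of the sample mean. -/
def sampleMean {n p : ℕ} (x : Fin n → Fin p → ℝ) (a : Fin p) : ℝ :=
  (∑ i, x i a) / (n : ℝ)

/-- The centered observations. -/
def centered {n p : ℕ} (x : Fin n → Fin p → ℝ) (i : Fin n) (a : Fin p) : ℝ :=
  x i a - sampleMean x a

/-- The `(a, b)` entry of the outer product of the `i`-th centered observation with itself. -/
def outerEntry {n p : ℕ} (x : Fin n → Fin p → ℝ) (i : Fin n) (a b : Fin p) : ℝ :=
  centered x i a * centered x i b

/-- The component `V_k(a, b)`. -/
def V {n p : ℕ} (x : Fin n → Fin p → ℝ) (k : ℕ) (a b : Fin p) : ℝ :=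
  1 / ((k : ℝ) * ((k : ℝ) - 1)) *
      ∑ i ∈ firstIdx n k, ∑ j ∈ (firstIdx n k).erase i, outerEntry x i a b * outerEntry x j a b
    + 1 / (((n : ℝ) - k) * ((n : ℝ) - k - 1)) *
      ∑ i ∈ lastIdx n k, ∑ j ∈ (lastIdx n k).erase i, outerEntry x i a b * outerEntry x j a b
    - 2 / ((k : ℝ) * ((n : ℝ) - k)) *
      ∑ i ∈ firstIdx n k, ∑ j ∈ lastIdx n k, outerEntry x i a b * outerEntry x j a b

/-- The weighted sum `D(a, b)` of the `V_k(a, b)` over `2 ≤ k ≤ n - 2`. -/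
def D {n p : ℕ} (x : Fin n → Fin p → ℝ) (a b : Fin p) : ℝ :=
  1 / ((n : ℝ) - 3) *
    ∑ k ∈ Finset.Icc 2 (n - 2), (k : ℝ) * ((n : ℝ) - k) / (n : ℝ) * V x k a b

/-- The set of components `(a, b)`, `a ≤ b`, that survive thresholding at level `τ`. -/
def kept {n p : ℕ} (x : Fin n → Fin p → ℝ) (τ : ℝ) : Finset (Fin p × Fin p) :=
  Finset.univ.filter (fun q => q.1 ≤ q.2 ∧ τ < D x q.1 q.2)

/-- The statistic `U_n(k)`; the innermost sum is the inner product of the differences of the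
half-vectorized outer products, restricted to the surviving components. -/
def U {n p : ℕ} (x : Fin n → Fin p → ℝ) (τ : ℝ) (k : ℕ) : ℝ :=
  1 / (n : ℝ) ^ 4 *
    ∑ i ∈ firstIdx n k, ∑ t ∈ (firstIdx n k).erase i,
      ∑ j ∈ lastIdx n k, ∑ l ∈ (lastIdx n k).erase j,
        ∑ q ∈ kept x τ,
          (outerEntry x i q.1 q.2 - outerEntry x j q.1 q.2) *
            (outerEntry x t q.1 q.2 - outerEntry x l q.1 q.2)

/-- `k` is a maximizer of `U_n` over `{1, …, n}`. -/
def IsArgmaxU {n p : ℕ} (x : Fin n → Fin p → ℝ) (τ : ℝ) (k : ℕ) : Prop :=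
  k ∈ Finset.Icc 1 n ∧ ∀ k' ∈ Finset.Icc 1 n, U x τ k' ≤ U x τ k

/-- The spectral norm of a real square matrix: its operator norm on Euclidean space. -/
def spectralNorm {p : ℕ} (S : Matrix (Fin p) (Fin p) ℝ) : ℝ :=
  ‖Matrix.toEuclideanCLM (n := Fin p) (𝕜 := ℝ) S‖

/-- The model: `n` independent square-integrable random vectors in `ℝᵖ` with a common mean; the first
`k₀` have covariance matrix `S₁`, the remaining `n - k₀` have covariance matrix `S₂ ≠ S₁`. -/
structure IsChangePointModel {Ω : Type u} [MeasurableSpace Ω] (P : Measure Ω) {n p : ℕ}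
    (X : Fin n → Ω → Fin p → ℝ) (k₀ : ℕ) (S₁ S₂ : Matrix (Fin p) (Fin p) ℝ) : Prop where
  one_le : 1 ≤ k₀
  lt : k₀ < n
  measurable : ∀ i, Measurable (X i)
  indep : iIndepFun X P
  memLp : ∀ i a, MemLp (fun ω => X i ω a) 2 P
  mean : ∃ m : Fin p → ℝ, ∀ i a, ∫ ω, X i ω a ∂P = m a
  cov_before : ∀ i : Fin n, i.val < k₀ → ∀ a b,
    cov[fun ω => X i ω a, fun ω => X i ω b; P] = S₁ a b
  cov_after : ∀ i : Fin n, k₀ ≤ i.val → ∀ a b,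
    cov[fun ω => X i ω a, fun ω => X i ω b; P] = S₂ a b
  ne : S₁ ≠ S₂

/-- All coordinates are sub-Gaussian with constants `C₁`, `C₂`, and both covariance matrices have
spectral norm at most `M`. -/
structure TailAndNormBound {Ω : Type u} [MeasurableSpace Ω] (P : Measure Ω) {n p : ℕ}
    (X : Fin n → Ω → Fin p → ℝ) (S₁ S₂ : Matrix (Fin p) (Fin p) ℝ) (C₁ C₂ M : ℝ) : Prop where
  tail : ∀ i a, ∀ t : ℝ, 0 < t → P.real {ω | t < |X i ω a|} ≤ C₁ * Real.exp (-C₂ * t ^ 2)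
  norm_before : spectralNorm S₁ ≤ M
  norm_after : spectralNorm S₂ ≤ M

/-- Minimal signal condition with constant `C`: the nonzero entries of `S₁ - S₂` exceed in absolute
value some `l ≥ C √(τ/n) max {n²/(n-k₀)², n²/k₀²}`. -/
def MinimalSignal {p : ℕ} (n k₀ : ℕ) (τ C : ℝ) (S₁ S₂ : Matrix (Fin p) (Fin p) ℝ) : Prop :=
  ∃ l : ℝ, (∀ a b, S₁ a b ≠ S₂ a b → l < |S₁ a b - S₂ a b|) ∧
    C * Real.sqrt (τ / n) *
      max ((n : ℝ) ^ 2 / ((n : ℝ) - k₀) ^ 2) ((n : ℝ) ^ 2 / (k₀ : ℝ) ^ 2) ≤ l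

/-- Growth conditions on sample sizes `n ν`, dimensions `p ν` and thresholds `τ ν`, with one
constant `c` in all three. -/
def GrowthConditions (n p : ℕ → ℕ) (τ : ℕ → ℝ) (c : ℝ) : Prop :=
  (fun ν => (p ν : ℝ) ^ 2 * n ν) =o[atTop] (fun ν => Real.exp (c * τ ν)) ∧
  (fun ν => (p ν : ℝ) ^ 2 * n ν) =o[atTop]
    (fun ν => Real.exp (c * (n ν : ℝ) ^ (1 / 4 : ℝ) * Real.sqrt (τ ν))) ∧
  (fun ν => (p ν : ℝ) ^ 2 * (n ν : ℝ) ^ 2) =o[atTop] (fun ν => Real.exp (c * Real.sqrt (τ ν)))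

end CovChangePoint

end

/-! Write r = τ^(1/4), so that √τ = r². The argument splits into a deterministic part on a good
event and a Bernstein bound for its complement.

On the good event (`GoodSample`), initial and final partial sums of m centred observations, and of
their products minus covariances, are at most K(r√m + r²), and single coordinates are at most Kr.
Passing from true to sample means only enlarges K (`GoodSample.noiseBound`). Both `D` and `U` are
built from one pair statistic (`weight_mul_V`, `U_eq_sum_pairStat`), which up to diagonal terms is a
squared CUSUM. The CUSUM of the mean sequence is a tent with peak at k₀ (`cusum_step`).

Thresholding: the noise in `D` averages to O(r³), below τ = r⁴ for large r, so unchanged components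
are discarded (`NoiseBound.avgStat_le`). The minimal signal puts changed components above τ
(`NoiseBound.lt_avgStat`). Localization: at distance at least εk₀ from k₀ the tent has dropped by
order εr²n^(3/2), against CUSUM noise of order rn^(3/2). For large r each surviving component
therefore has a strictly smaller pair statistic at k than at k₀ (`NoiseBound.pairStat_lt`), and so
does the sum `U` (`GoodSample.dist_lt`).

The good event fails with probability O(p²n exp(-κ√τ)). The rate κ is arbitrary: a larger κ only
costs a larger K, hence a larger lower bound on τ (`exists_threshold_measureReal_le`). Small τ are
absorbed into c₅ in the inequality; in the consistency statement the growth condition forces τ → ∞.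
-/

namespace CovChangePoint

/-! ### The pair statistic -/

/-- Sum of `(y i - y j) * (y t - y l)` over ordered pairs `i ≠ t` in `A` and `j ≠ l` in `B`. -/
def pairSum {ι : Type*} [DecidableEq ι] (y : ι → ℝ) (A B : Finset ι) : ℝ :=
  ∑ i ∈ A, ∑ t ∈ A.erase i, ∑ j ∈ B, ∑ l ∈ B.erase j, (y i - y j) * (y t - y l)

lemma sum_sum_erase_mul {ι : Type*} [DecidableEq ι] (y : ι → ℝ) (A : Finset ι) :
    ∑ i ∈ A, ∑ j ∈ A.erase i, y i * y j = (∑ i ∈ A, y i) ^ 2 - ∑ i ∈ A, y i ^ 2 := by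
  have : ∀ i ∈ A, ∑ j ∈ A.erase i, y i * y j = y i * (∑ j ∈ A, y j) - y i ^ 2 := by
    intro i hi
    rw [Finset.sum_erase_eq_sub hi, Finset.mul_sum]; ring
  rw [Finset.sum_congr rfl this, Finset.sum_sub_distrib, ← Finset.sum_mul]; ring

/-- Only sums and sums of squares over the two blocks enter. This form allows comparison both with a
squared CUSUM and with `V`. -/
lemma pairSum_eq {ι : Type*} [DecidableEq ι] (y : ι → ℝ) (A B : Finset ι) :
    pairSum y A B =
      (B.card : ℝ) * (B.card - 1) * ((∑ i ∈ A, y i) ^ 2 - ∑ i ∈ A, y i ^ 2)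
      + (A.card : ℝ) * (A.card - 1) * ((∑ i ∈ B, y i) ^ 2 - ∑ i ∈ B, y i ^ 2)
      - 2 * ((A.card : ℝ) - 1) * (B.card - 1) * (∑ i ∈ A, y i) * ∑ i ∈ B, y i := by
  have inner : ∀ u v : ℝ, ∑ j ∈ B, ∑ l ∈ B.erase j, (u - y j) * (v - y l)
      = (B.card : ℝ) * (B.card - 1) * (u * v) - (u + v) * ((B.card : ℝ) - 1) * ∑ i ∈ B, y i
        + ((∑ i ∈ B, y i) ^ 2 - ∑ i ∈ B, y i ^ 2) := by
    intro u v
    have : ∀ j ∈ B, ∑ l ∈ B.erase j, (u - y j) * (v - y l)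
        = (u - y j) * (B.card * v - ∑ l ∈ B, y l) - (u - y j) * (v - y j) := by
      intro j hj
      rw [Finset.sum_erase_eq_sub hj, ← Finset.mul_sum, Finset.sum_sub_distrib]
      simp
    rw [Finset.sum_congr rfl this, Finset.sum_sub_distrib, ← Finset.sum_mul,
      Finset.sum_sub_distrib]
    have h2 : ∑ j ∈ B, (u - y j) * (v - y j)
        = B.card * (u * v) - (u + v) * (∑ j ∈ B, y j) + ∑ j ∈ B, y j ^ 2 := by
      rw [Finset.mul_sum, ← nsmul_eq_mul, ← Finset.sum_const, ← Finset.sum_sub_distrib,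
        ← Finset.sum_add_distrib]
      exact Finset.sum_congr rfl fun j _ => by ring
    rw [h2]; simp; ring
  unfold pairSum
  set SB := ∑ i ∈ B, y i
  set QB := ∑ i ∈ B, y i ^ 2
  have : ∀ i ∈ A, ∑ t ∈ A.erase i, ∑ j ∈ B, ∑ l ∈ B.erase j, (y i - y j) * (y t - y l)
      = (B.card : ℝ) * (B.card - 1) * (∑ t ∈ A.erase i, y i * y t)
        - ((B.card : ℝ) - 1) * SB * (((A.card : ℝ) - 1) * y i + (∑ t ∈ A, y t - y i))
        + ((A.card : ℝ) - 1) * (SB ^ 2 - QB) := by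
    intro i hi
    have hc : ((A.erase i).card : ℝ) = (A.card : ℝ) - 1 := by
      rw [Finset.card_erase_of_mem hi, Nat.cast_sub (Finset.card_pos.2 ⟨i, hi⟩)]; simp
    simp_rw [inner]
    rw [Finset.sum_add_distrib, Finset.sum_sub_distrib, ← Finset.mul_sum, Finset.sum_const,
      nsmul_eq_mul, hc]
    congr 2
    rw [← Finset.sum_erase_eq_sub hi, ← hc, ← nsmul_eq_mul, ← Finset.sum_const,
      ← Finset.sum_add_distrib, Finset.mul_sum]
    exact Finset.sum_congr rfl fun t _ => by ring
  rw [Finset.sum_congr rfl this, Finset.sum_add_distrib, Finset.sum_sub_distrib, ← Finset.mul_sum,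
    sum_sum_erase_mul, ← Finset.mul_sum, Finset.sum_add_distrib, ← Finset.mul_sum,
    Finset.sum_sub_distrib]
  simp; ring

/-- Up to diagonal terms the pair statistic is the square of a weighted difference of sums. -/
lemma abs_pairSum_sub_sq_le {ι : Type*} [DecidableEq ι] (y : ι → ℝ) (A B : Finset ι)
    (hn : 1 ≤ A.card + B.card) :
    |pairSum y A B - ((B.card : ℝ) * (∑ i ∈ A, y i) - A.card * ∑ i ∈ B, y i) ^ 2| ≤
      2 * ((A.card : ℝ) + B.card) *
        (B.card * (∑ i ∈ A, y i ^ 2) + A.card * ∑ i ∈ B, y i ^ 2) := by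
  have hA : (∑ i ∈ A, y i) ^ 2 ≤ A.card * ∑ i ∈ A, y i ^ 2 := sq_sum_le_card_mul_sum_sq
  have hB : (∑ i ∈ B, y i) ^ 2 ≤ B.card * ∑ i ∈ B, y i ^ 2 := sq_sum_le_card_mul_sum_sq
  have hQA : 0 ≤ ∑ i ∈ A, y i ^ 2 := Finset.sum_nonneg fun i _ => sq_nonneg _
  have hQB : 0 ≤ ∑ i ∈ B, y i ^ 2 := Finset.sum_nonneg fun i _ => sq_nonneg _
  rw [pairSum_eq]
  have hn' : (1 : ℝ) ≤ (A.card : ℝ) + B.card := by exact_mod_cast hn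
  have hk : (0 : ℝ) ≤ A.card := by positivity
  have hm : (0 : ℝ) ≤ B.card := by positivity
  generalize (∑ i ∈ A, y i) = s at *
  generalize (∑ i ∈ B, y i) = t at *
  generalize (∑ i ∈ A, y i ^ 2) = q at *
  generalize (∑ i ∈ B, y i ^ 2) = w at *
  generalize (A.card : ℝ) = k at *
  generalize (B.card : ℝ) = m at *
  -- Expanding the difference leaves the cross term 2(k + m - 1)st. Cauchy–Schwarz bounds (st)² by
  -- (kq)(mw) = (mq)(kw), and AM-GM then yields the weights of the claim.
  have hst : |s * t| ≤ (m * q + k * w) / 2 := by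
    apply abs_le_of_sq_le_sq _ (by positivity)
    calc (s * t) ^ 2 = s ^ 2 * t ^ 2 := by ring
      _ ≤ (k * q) * (m * w) := by gcongr
      _ ≤ ((m * q + k * w) / 2) ^ 2 := by nlinarith [sq_nonneg (m * q - k * w)]
  have h1 : m * s ^ 2 ≤ m * (k * q) := by gcongr
  have h2 : k * t ^ 2 ≤ k * (m * w) := by gcongr
  obtain ⟨h3, h4⟩ := abs_le.1 hst
  have hm1 : 0 ≤ m * q := by positivity
  have hk1 : 0 ≤ k * w := by positivity
  have h5 := mul_le_mul_of_nonneg_left h4 (sub_nonneg.2 hn')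
  have h6 := mul_le_mul_of_nonneg_left h3 (sub_nonneg.2 hn')
  have h7 : 0 ≤ m * s ^ 2 := by positivity
  have h8 : 0 ≤ k * t ^ 2 := by positivity
  have h9 : 0 ≤ m * (m * q) := by positivity
  have h10 : 0 ≤ k * (k * w) := by positivity
  have h11 : 0 ≤ k * (m * q) := by positivity
  have h12 : 0 ≤ m * (k * w) := by positivity
  rw [abs_le]
  constructor <;> nlinarith

lemma card_firstIdx {n k : ℕ} (hk : k ≤ n) : (firstIdx n k).card = k := by
  have : firstIdx n k = (Finset.univ : Finset (Fin k)).map (Fin.castLEEmb hk) := by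
    ext i
    simp only [firstIdx, Finset.mem_filter, Finset.mem_univ, true_and, Finset.mem_map]
    constructor
    · intro h; exact ⟨⟨i, h⟩, by ext; simp⟩
    · rintro ⟨j, rfl⟩; simp
  rw [this]; simp

lemma lastIdx_eq_compl (n k : ℕ) : lastIdx n k = (firstIdx n k)ᶜ := by
  ext i; simp [firstIdx, lastIdx]

lemma card_lastIdx {n k : ℕ} (hk : k ≤ n) : (lastIdx n k).card = n - k := by
  rw [lastIdx_eq_compl, Finset.card_compl, card_firstIdx hk]; simp

lemma sum_firstIdx_add_sum_lastIdx {n : ℕ} (k : ℕ) (y : Fin n → ℝ) :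
    ∑ i ∈ firstIdx n k, y i + ∑ i ∈ lastIdx n k, y i = ∑ i, y i := by
  rw [lastIdx_eq_compl, Finset.sum_add_sum_compl]

/-- The pair statistic of the split at `k`. -/
def pairStat {n : ℕ} (y : Fin n → ℝ) (k : ℕ) : ℝ := pairSum y (firstIdx n k) (lastIdx n k)

/-- The unnormalized CUSUM statistic of the split at `k`. -/
def cusum {n : ℕ} (y : Fin n → ℝ) (k : ℕ) : ℝ :=
  ((n : ℝ) - k) * (∑ i ∈ firstIdx n k, y i) - k * ∑ i ∈ lastIdx n k, y i

lemma abs_pairStat_sub_cusum_sq_le {n k : ℕ} (hn : 1 ≤ n) (hk : k ≤ n) (y : Fin n → ℝ) :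
    |pairStat y k - cusum y k ^ 2| ≤ 2 * (n : ℝ) *
      (((n : ℝ) - k) * (∑ i ∈ firstIdx n k, y i ^ 2) + k * ∑ i ∈ lastIdx n k, y i ^ 2) := by
  have h := abs_pairSum_sub_sq_le y (firstIdx n k) (lastIdx n k)
    (by rw [card_firstIdx hk, card_lastIdx hk]; omega)
  rw [card_firstIdx hk, card_lastIdx hk, Nat.cast_sub hk] at h
  simpa [pairStat, cusum] using h

lemma U_eq_sum_pairStat {n p : ℕ} (x : Fin n → Fin p → ℝ) (τ : ℝ) (k : ℕ) :
    U x τ k = 1 / (n : ℝ) ^ 4 *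
      ∑ q ∈ kept x τ, pairStat (fun i => outerEntry x i q.1 q.2) k := by
  unfold U pairStat pairSum
  congr 1
  symm
  rw [Finset.sum_comm]
  refine Finset.sum_congr rfl fun i _ => ?_
  rw [Finset.sum_comm]
  refine Finset.sum_congr rfl fun t _ => ?_
  rw [Finset.sum_comm]
  refine Finset.sum_congr rfl fun j _ => ?_
  rw [Finset.sum_comm]

/-- `V` is the pair statistic divided by its number k(k-1)(n-k)(n-k-1) of quadruples; the weight
cancels the factors k and n - k. Hence one noise analysis serves both the thresholding and the
maximization. -/
lemma weight_mul_V {n p : ℕ} (x : Fin n → Fin p → ℝ) {k : ℕ} (hk : 2 ≤ k) (hkn : k + 2 ≤ n)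
    (a b : Fin p) :
    (k : ℝ) * ((n : ℝ) - k) / n * V x k a b =
      pairStat (fun i => outerEntry x i a b) k / (((k : ℝ) - 1) * ((n : ℝ) - k - 1) * n) := by
  have hkn' : k ≤ n := by omega
  rw [pairStat, pairSum_eq, card_firstIdx hkn', card_lastIdx hkn', Nat.cast_sub hkn']
  unfold V
  rw [sum_sum_erase_mul (fun i => outerEntry x i a b), sum_sum_erase_mul
    (fun i => outerEntry x i a b), ← Finset.sum_mul_sum]
  have h1 : (2 : ℝ) ≤ k := by exact_mod_cast hk
  have h2 : (k : ℝ) + 2 ≤ n := by exact_mod_cast hkn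
  have e1 : (k : ℝ) ≠ 0 := by linarith
  have e2 : (k : ℝ) - 1 ≠ 0 := by linarith
  have e3 : (n : ℝ) - k ≠ 0 := by linarith
  have e4 : (n : ℝ) - k - 1 ≠ 0 := by linarith
  have e5 : (n : ℝ) ≠ 0 := by linarith
  field_simp

lemma D_eq_sum_pairStat {n p : ℕ} (x : Fin n → Fin p → ℝ) (a b : Fin p) :
    D x a b = 1 / ((n : ℝ) - 3) * ∑ k ∈ Finset.Icc 2 (n - 2),
      pairStat (fun i => outerEntry x i a b) k / (((k : ℝ) - 1) * ((n : ℝ) - k - 1) * n) := by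
  unfold D
  congr 1
  refine Finset.sum_congr rfl fun k hk => ?_
  rw [Finset.mem_Icc] at hk
  exact weight_mul_V x hk.1 (by omega) a b

end CovChangePoint

namespace CovChangePoint

/-! ### Deterministic consequences of bounds on the noise -/

lemma cusum_add {n : ℕ} (y z : Fin n → ℝ) (k : ℕ) :
    cusum (fun i => y i + z i) k = cusum y k + cusum z k := by
  simp only [cusum, Finset.sum_add_distrib]; ring

/-- The second factor is a tent in k: k(n - k₀) up to k₀ and k₀(n - k) afterwards. -/
lemma cusum_step {n k k₀ : ℕ} (hk : k ≤ n) (hk₀ : k₀ ≤ n) (s₁ s₂ : ℝ) :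
    cusum (fun i : Fin n => if i.val < k₀ then s₁ else s₂) k =
      (s₁ - s₂) * ((n : ℝ) * (min k k₀ : ℕ) - k * k₀) := by
  have hf : ∀ j : ℕ, j ≤ n → ∑ i ∈ firstIdx n j, (if i.val < k₀ then s₁ else s₂)
      = (s₁ - s₂) * (min j k₀ : ℕ) + j * s₂ := by
    intro j hj
    have : ∀ i : Fin n, (if i.val < k₀ then s₁ else s₂)
        = (if i.val < k₀ then s₁ - s₂ else 0) + s₂ := by
      intro i; split_ifs <;> ring
    simp_rw [this]
    rw [Finset.sum_add_distrib, ← Finset.sum_filter, Finset.sum_const, Finset.sum_const,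
      card_firstIdx hj]
    have h2 : (firstIdx n j).filter (fun i => i.val < k₀) = firstIdx n (min j k₀) := by
      ext i; simp [firstIdx]
    rw [h2, card_firstIdx (by omega)]
    simp only [nsmul_eq_mul]; ring
  have hall : ∑ i : Fin n, (if i.val < k₀ then s₁ else s₂) = (s₁ - s₂) * k₀ + n * s₂ := by
    have h := hf n le_rfl
    rw [min_eq_right hk₀] at h
    rw [← h]
    congr 1; ext i; simp [firstIdx]
  have hl := sum_firstIdx_add_sum_lastIdx k (fun i : Fin n => if i.val < k₀ then s₁ else s₂)
  rw [hall, hf k hk] at hl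
  rw [cusum, hf k hk, eq_sub_of_add_eq' hl]; ring

/-- Bounds on the partial sums of a noise sequence `ξ` and on the size of a sequence `y`, at noise
level `r`. -/
structure NoiseBound {n : ℕ} (ξ y : Fin n → ℝ) (K r : ℝ) : Prop where
  first : ∀ k ≤ n, |∑ i ∈ firstIdx n k, ξ i| ≤ K * (r * √(k : ℝ) + r ^ 2)
  last : ∀ k ≤ n, |∑ i ∈ lastIdx n k, ξ i| ≤ K * (r * √((n : ℝ) - k) + r ^ 2)
  sq_le : ∀ i, y i ^ 2 ≤ K * r ^ 4
  sum_sq : ∑ i, y i ^ 2 ≤ K * n * r ^ 2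

section

variable {n : ℕ} {ξ y : Fin n → ℝ} {K r : ℝ}

lemma NoiseBound.abs_cusum_le (h : NoiseBound ξ y K r) {k : ℕ} (hk : k ≤ n) :
    |cusum ξ k| ≤ ((n : ℝ) - k) * (K * (r * √(k : ℝ) + r ^ 2)) +
      k * (K * (r * √((n : ℝ) - k) + r ^ 2)) := by
  have hk' : (k : ℝ) ≤ n := by exact_mod_cast hk
  have hm : (0 : ℝ) ≤ (n : ℝ) - k := by linarith
  unfold cusum
  refine (abs_sub _ _).trans ?_
  rw [abs_mul, abs_mul, abs_of_nonneg hm, abs_of_nonneg (Nat.cast_nonneg (α := ℝ) k)]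
  gcongr
  · exact h.first k hk
  · exact h.last k hk

lemma pow_four_le_cast_imp (hr : 1 ≤ r) (hrn : r ^ 4 ≤ n) : r ≤ √(n : ℝ) ∧ (1 : ℝ) ≤ n := by
  refine ⟨Real.le_sqrt_of_sq_le ?_, ?_⟩
  · exact le_trans (pow_le_pow_right₀ hr (by norm_num)) hrn
  · exact le_trans (one_le_pow₀ hr) hrn

/-- Since r⁴ ≤ n, the term r² is absorbed by r√n. -/
lemma NoiseBound.abs_cusum_le_uniform (h : NoiseBound ξ y K r) (hK : 1 ≤ K) (hr : 1 ≤ r)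
    (hrn : r ^ 4 ≤ n) {k : ℕ} (hk : k ≤ n) : |cusum ξ k| ≤ 2 * K * r * n * √(n : ℝ) := by
  have hk' : (k : ℝ) ≤ n := by exact_mod_cast hk
  have hm : (0 : ℝ) ≤ (n : ℝ) - k := by linarith
  obtain ⟨h1, _⟩ := pow_four_le_cast_imp hr hrn
  have h2 : √(k : ℝ) ≤ √(n : ℝ) := Real.sqrt_le_sqrt hk'
  have h3 : √((n : ℝ) - k) ≤ √(n : ℝ) := Real.sqrt_le_sqrt (by linarith [Nat.cast_nonneg (α := ℝ) k])
  have h4 : ∀ s : ℝ, s ≤ √(n : ℝ) → K * (r * s + r ^ 2) ≤ 2 * K * r * √(n : ℝ) := by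
    intro s hs
    have : r * s + r ^ 2 ≤ 2 * (r * √(n : ℝ)) := by nlinarith
    nlinarith
  calc |cusum ξ k| ≤ _ := h.abs_cusum_le hk
    _ ≤ ((n : ℝ) - k) * (2 * K * r * √(n : ℝ)) + k * (2 * K * r * √(n : ℝ)) := by
        exact add_le_add (mul_le_mul_of_nonneg_left (h4 _ h2) hm)
          (mul_le_mul_of_nonneg_left (h4 _ h3) (Nat.cast_nonneg k))
    _ = 2 * K * r * n * √(n : ℝ) := by ring

lemma NoiseBound.abs_pairStat_sub_le (h : NoiseBound ξ y K r) (hn : 1 ≤ n) {k : ℕ} (hk : k ≤ n) :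
    |pairStat y k - cusum y k ^ 2| ≤ 2 * K * r ^ 2 * (n : ℝ) ^ 3 := by
  have hk' : (k : ℝ) ≤ n := by exact_mod_cast hk
  have hs := sum_firstIdx_add_sum_lastIdx k (fun i : Fin n => y i ^ 2)
  have hf : 0 ≤ ∑ i ∈ firstIdx n k, y i ^ 2 := Finset.sum_nonneg fun i _ => sq_nonneg _
  have hl : 0 ≤ ∑ i ∈ lastIdx n k, y i ^ 2 := Finset.sum_nonneg fun i _ => sq_nonneg _
  have h1 := h.sum_sq
  calc |pairStat y k - cusum y k ^ 2| ≤ _ := abs_pairStat_sub_cusum_sq_le hn hk y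
    _ ≤ 2 * (n : ℝ) * (n * (∑ i ∈ firstIdx n k, y i ^ 2) + n * ∑ i ∈ lastIdx n k, y i ^ 2) := by
        gcongr
        linarith [Nat.cast_nonneg (α := ℝ) k]
    _ = 2 * (n : ℝ) ^ 2 * ∑ i, y i ^ 2 := by rw [← hs]; ring
    _ ≤ 2 * (n : ℝ) ^ 2 * (K * n * r ^ 2) := by gcongr
    _ = _ := by ring

/-- Away from the change point the pair statistic is strictly below its value there. -/
lemma NoiseBound.pairStat_lt (h : NoiseBound ξ y K r) (hK : 1 ≤ K) (hr : 1 ≤ r)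
    (hrn : r ^ 4 ≤ n) {k k₀ : ℕ} (hk : k ≤ n) (hk₀ : k₀ ≤ n) {s₁ s₂ ε C : ℝ} (hC : 1 ≤ C)
    (hε : 0 < ε) (hrε : 8 * K ≤ ε * r)
    (hy : ∀ i, y i = (if i.val < k₀ then s₁ else s₂) + ξ i)
    (hs₁ : C * r ^ 2 * n ^ 2 ≤ |s₁ - s₂| * √(n : ℝ) * (k₀ : ℝ) ^ 2)
    (hs₂ : C * r ^ 2 * n ^ 2 ≤ |s₁ - s₂| * √(n : ℝ) * ((n : ℝ) - k₀) ^ 2)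
    (hdist : ε * k₀ ≤ |(k : ℝ) - k₀|) : pairStat y k < pairStat y k₀ := by
  obtain ⟨h1, hn1⟩ := pow_four_le_cast_imp hr hrn
  have hn : 1 ≤ n := by exact_mod_cast hn1
  have hN : 0 < √(n : ℝ) := by linarith
  have hNN : √(n : ℝ) * √(n : ℝ) = n := Real.mul_self_sqrt (by linarith)
  have hkr : (k : ℝ) ≤ n := by exact_mod_cast hk
  have hk₀r : (k₀ : ℝ) ≤ n := by exact_mod_cast hk₀
  have hkp : (0 : ℝ) ≤ k := Nat.cast_nonneg k
  have hk₀p : (0 : ℝ) ≤ k₀ := Nat.cast_nonneg k₀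
  have hyf : y = fun i => (if i.val < k₀ then s₁ else s₂) + ξ i := funext hy
  have hT : ∀ j ≤ n, cusum y j = (s₁ - s₂) * ((n : ℝ) * (min j k₀ : ℕ) - j * k₀) + cusum ξ j := by
    intro j hj
    rw [hyf, cusum_add, cusum_step hj hk₀]
  have hT0 := hT k₀ hk₀
  have hTk := hT k hk
  have he0 := h.abs_cusum_le_uniform hK hr hrn hk₀
  have hek := h.abs_cusum_le_uniform hK hr hrn hk
  have hr0 := h.abs_pairStat_sub_le hn hk₀
  have hrk := h.abs_pairStat_sub_le hn hk
  rw [min_self] at hT0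
  set δ := |s₁ - s₂| with hδ
  have hδ0 : 0 ≤ δ := abs_nonneg _
  set H0 : ℝ := (n : ℝ) * k₀ - k₀ * k₀ with hH0
  set Hk : ℝ := (n : ℝ) * (min k k₀ : ℕ) - k * k₀ with hHk
  set e : ℝ := 2 * K * r * n * √(n : ℝ) with he
  -- The drop of the tent is (k₀ - k)(n - k₀) on the left and k₀(k - k₀) on the right. The distance
  -- condition replaces |k - k₀| by εk₀; k₀(n - k₀) is at least the square of its smaller factor, so
  -- the two signal conditions suffice.
  have hg : Hk ≤ H0 ∧ 0 ≤ Hk ∧ ε * (r ^ 2 * n * √(n : ℝ)) ≤ δ * (H0 - Hk) := by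
    have hw1 : r ^ 2 * n * √(n : ℝ) ≤ δ * (k₀ : ℝ) ^ 2 := by
      have : r ^ 2 * n * √(n : ℝ) * √(n : ℝ) ≤ δ * (k₀ : ℝ) ^ 2 * √(n : ℝ) := by
        calc _ = 1 * (r ^ 2 * n * (√(n : ℝ) * √(n : ℝ))) := by ring
          _ ≤ C * (r ^ 2 * n * (√(n : ℝ) * √(n : ℝ))) := by gcongr
          _ = C * r ^ 2 * n ^ 2 := by rw [hNN]; ring
          _ ≤ _ := by linarith
      exact le_of_mul_le_mul_right this hN
    have hw2 : r ^ 2 * n * √(n : ℝ) ≤ δ * ((n : ℝ) - k₀) ^ 2 := by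
      have : r ^ 2 * n * √(n : ℝ) * √(n : ℝ) ≤ δ * ((n : ℝ) - k₀) ^ 2 * √(n : ℝ) := by
        calc _ = 1 * (r ^ 2 * n * (√(n : ℝ) * √(n : ℝ))) := by ring
          _ ≤ C * (r ^ 2 * n * (√(n : ℝ) * √(n : ℝ))) := by gcongr
          _ = C * r ^ 2 * n ^ 2 := by rw [hNN]; ring
          _ ≤ _ := by linarith
      exact le_of_mul_le_mul_right this hN
    rcases le_total k k₀ with hkk | hkk
    · have hkk' : (k : ℝ) ≤ k₀ := by exact_mod_cast hkk
      rw [abs_of_nonpos (by linarith)] at hdist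
      have hm : 0 ≤ (n : ℝ) - k₀ := by linarith
      have e1 : Hk = k * ((n : ℝ) - k₀) := by rw [hHk, min_eq_left hkk]; ring
      have e2 : H0 - Hk = (k₀ - k) * ((n : ℝ) - k₀) := by rw [e1, hH0]; ring
      have hw3 : r ^ 2 * n * √(n : ℝ) ≤ δ * (k₀ * ((n : ℝ) - k₀)) := by
        rcases le_total (k₀ : ℝ) ((n : ℝ) - k₀) with hc | hc
        · refine hw1.trans (mul_le_mul_of_nonneg_left ?_ hδ0)
          rw [sq]
          exact mul_le_mul_of_nonneg_left hc hk₀p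
        · refine hw2.trans (mul_le_mul_of_nonneg_left ?_ hδ0)
          rw [sq]
          exact mul_le_mul_of_nonneg_right hc hm
      refine ⟨?_, by rw [e1]; positivity, ?_⟩
      · have : 0 ≤ H0 - Hk := by rw [e2]; exact mul_nonneg (by linarith) hm
        linarith
      · rw [e2]
        calc ε * (r ^ 2 * n * √(n : ℝ)) ≤ ε * (δ * (k₀ * ((n : ℝ) - k₀))) := by gcongr
          _ = δ * ((ε * k₀) * ((n : ℝ) - k₀)) := by ring
          _ ≤ δ * ((k₀ - k) * ((n : ℝ) - k₀)) := by gcongr; linarith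
    · have hkk' : (k₀ : ℝ) ≤ k := by exact_mod_cast hkk
      rw [abs_of_nonneg (by linarith)] at hdist
      have e1 : Hk = k₀ * ((n : ℝ) - k) := by rw [hHk, min_eq_right hkk]; ring
      have e2 : H0 - Hk = k₀ * (k - k₀) := by rw [e1, hH0]; ring
      refine ⟨?_, by rw [e1]; exact mul_nonneg hk₀p (by linarith), ?_⟩
      · have : 0 ≤ H0 - Hk := by rw [e2]; exact mul_nonneg hk₀p (by linarith)
        linarith
      · rw [e2]
        calc ε * (r ^ 2 * n * √(n : ℝ)) ≤ ε * (δ * (k₀ : ℝ) ^ 2) := by gcongr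
          _ = δ * (k₀ * (ε * k₀)) := by ring
          _ ≤ δ * (k₀ * (k - k₀)) := by gcongr
  obtain ⟨hH1, hH2, hg1⟩ := hg
  have he_pos : 0 < e := by positivity
  -- The signal gap carries one more factor r than the noise e, so a large r makes up for a small ε
  -- without any demand on C.
  have hge : 4 * e ≤ δ * (H0 - Hk) := by
    refine le_trans ?_ hg1
    calc 4 * e = (8 * K) * (r * n * √(n : ℝ)) := by rw [he]; ring
      _ ≤ (ε * r) * (r * n * √(n : ℝ)) := by gcongr
      _ = _ := by ring
  have ha0 : δ * H0 - e ≤ |cusum y k₀| := by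
    rw [hT0]
    have h3 := abs_sub_abs_le_abs_sub ((s₁ - s₂) * H0) (-cusum ξ k₀)
    rw [abs_neg, sub_neg_eq_add, abs_mul, abs_of_nonneg (hH2.trans hH1)] at h3
    linarith
  have hak : |cusum y k| ≤ δ * Hk + e := by
    rw [hTk]
    refine (abs_add_le _ _).trans ?_
    rw [abs_mul, abs_of_nonneg hH2]
    linarith
  have hpos : 0 ≤ δ * Hk := mul_nonneg hδ0 hH2
  have hsq0 : (δ * H0 - e) ^ 2 ≤ cusum y k₀ ^ 2 := by
    rw [← sq_abs (cusum y k₀)]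
    exact pow_le_pow_left₀ (by linarith) ha0 2
  have hsqk : cusum y k ^ 2 ≤ (δ * Hk + e) ^ 2 := by
    rw [← sq_abs (cusum y k)]
    exact pow_le_pow_left₀ (abs_nonneg _) hak 2
  -- Here 8e² = 32K²r²n³, while the diagonal errors at k and k₀ total at most 4Kr²n³.
  have hdiff : 8 * e ^ 2 ≤ (δ * H0 - e) ^ 2 - (δ * Hk + e) ^ 2 := by
    have : (δ * H0 - e) ^ 2 - (δ * Hk + e) ^ 2
        = (δ * (H0 - Hk) + 2 * (δ * Hk)) * (δ * (H0 - Hk) - 2 * e) := by ring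
    rw [this]
    calc 8 * e ^ 2 = (4 * e) * (2 * e) := by ring
      _ ≤ _ := mul_le_mul (by linarith) (by linarith) (by linarith) (by linarith)
  have hee : e ^ 2 = 4 * K ^ 2 * r ^ 2 * (n : ℝ) ^ 3 := by
    rw [he]
    calc _ = 4 * K ^ 2 * r ^ 2 * n ^ 2 * (√(n : ℝ) * √(n : ℝ)) := by ring
      _ = _ := by rw [hNN]; ring
  have hKK : K * (r ^ 2 * (n : ℝ) ^ 3) ≤ K ^ 2 * (r ^ 2 * (n : ℝ) ^ 3) := by
    gcongr; exact le_self_pow₀ hK (by norm_num)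
  have hKpos : 0 < K * (r ^ 2 * (n : ℝ) ^ 3) := by positivity
  have i1 := (abs_le.1 hr0).1
  have i2 := (abs_le.1 hrk).2
  linarith

/-! ### Thresholding: the size of `D` with and without a change. -/

lemma sum_inv_sqrt_le (N : ℕ) : ∑ k ∈ Finset.Icc 1 N, 1 / √(k : ℝ) ≤ 2 * √(N : ℝ) := by
  induction N with
  | zero => simp
  | succ N ih =>
    rw [Finset.sum_Icc_succ_top (by omega)]
    have h0 : 0 ≤ √(N : ℝ) := Real.sqrt_nonneg _
    have h1 : 0 < √((N + 1 : ℕ) : ℝ) := Real.sqrt_pos.2 (by positivity)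
    have h2 : √(N : ℝ) * √(N : ℝ) = N := Real.mul_self_sqrt (by positivity)
    have h3 : √((N + 1 : ℕ) : ℝ) * √((N + 1 : ℕ) : ℝ) = N + 1 := by
      rw [Real.mul_self_sqrt (by positivity)]; push_cast; ring
    have h4 : 1 / √((N + 1 : ℕ) : ℝ) ≤ 2 * √((N + 1 : ℕ) : ℝ) - 2 * √(N : ℝ) := by
      rw [div_le_iff₀ h1]
      nlinarith [sq_nonneg (√((N + 1 : ℕ) : ℝ) - √(N : ℝ))]
    linarith

lemma sum_inv_sqrt_add_le (n : ℕ) :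
    ∑ k ∈ Finset.Icc 2 (n - 2), (1 / √(k : ℝ) + 1 / √((n : ℝ) - k)) ≤ 4 * √(n : ℝ) := by
  have h1 : ∑ k ∈ Finset.Icc 2 (n - 2), 1 / √(k : ℝ) ≤ 2 * √(n : ℝ) := by
    refine le_trans (Finset.sum_le_sum_of_subset_of_nonneg ?_ fun _ _ _ => by positivity)
      (sum_inv_sqrt_le n)
    intro k; simp only [Finset.mem_Icc]; omega
  have h2 : ∑ k ∈ Finset.Icc 2 (n - 2), 1 / √((n : ℝ) - k)
      = ∑ k ∈ Finset.Icc 2 (n - 2), 1 / √(k : ℝ) := by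
    refine Finset.sum_nbij' (fun k => n - k) (fun k => n - k) ?_ ?_ ?_ ?_ ?_
    · intro k; simp only [Finset.mem_Icc]; omega
    · intro k; simp only [Finset.mem_Icc]; omega
    · intro k; simp only [Finset.mem_Icc]; omega
    · intro k; simp only [Finset.mem_Icc]; omega
    · intro k hk
      rw [Finset.mem_Icc] at hk
      rw [Nat.cast_sub (by omega)]
  rw [Finset.sum_add_distrib, h2]
  linarith

/-- The noise part of one summand of `D`. -/
lemma NoiseBound.noise_term_le (h : NoiseBound ξ y K r) (hK : 1 ≤ K) (hr : 1 ≤ r)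
    (hrn : r ^ 4 ≤ n) {k : ℕ} (hk : 2 ≤ k) (hkn : k + 2 ≤ n) :
    (cusum ξ k ^ 2 + |pairStat y k - cusum y k ^ 2|) / (((k : ℝ) - 1) * ((n : ℝ) - k - 1) * n) ≤
      40 * K ^ 2 * r ^ 3 * √(n : ℝ) * (1 / √(k : ℝ) + 1 / √((n : ℝ) - k)) := by
  obtain ⟨hrN, hn1⟩ := pow_four_le_cast_imp hr hrn
  have hkn' : k ≤ n := by omega
  have hk2 : (2 : ℝ) ≤ k := by exact_mod_cast hk
  have hkn2 : (k : ℝ) + 2 ≤ n := by exact_mod_cast hkn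
  have hE := h.abs_cusum_le hkn'
  have hQ := abs_pairStat_sub_cusum_sq_le (by omega) hkn' y
  have hA1 : ∑ i ∈ firstIdx n k, y i ^ 2 ≤ k * (K * r ^ 4) := by
    have := Finset.sum_le_card_nsmul (firstIdx n k) (fun i => y i ^ 2) _ fun i _ => h.sq_le i
    rwa [card_firstIdx hkn', nsmul_eq_mul] at this
  have hB1 : ∑ i ∈ lastIdx n k, y i ^ 2 ≤ ((n : ℝ) - k) * (K * r ^ 4) := by
    have := Finset.sum_le_card_nsmul (lastIdx n k) (fun i => y i ^ 2) _ fun i _ => h.sq_le i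
    rwa [card_lastIdx hkn', nsmul_eq_mul, Nat.cast_sub hkn'] at this
  have hA0 : 0 ≤ ∑ i ∈ firstIdx n k, y i ^ 2 := Finset.sum_nonneg fun i _ => sq_nonneg _
  have hB0 : 0 ≤ ∑ i ∈ lastIdx n k, y i ^ 2 := Finset.sum_nonneg fun i _ => sq_nonneg _
  have hs := sum_firstIdx_add_sum_lastIdx k (fun i : Fin n => y i ^ 2)
  have hA2 : ∑ i ∈ firstIdx n k, y i ^ 2 ≤ K * n * r ^ 2 := by linarith [h.sum_sq]
  have hB2 : ∑ i ∈ lastIdx n k, y i ^ 2 ≤ K * n * r ^ 2 := by linarith [h.sum_sq]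
  set A := ∑ i ∈ firstIdx n k, y i ^ 2
  set B := ∑ i ∈ lastIdx n k, y i ^ 2
  obtain ⟨m, hm⟩ : ∃ m : ℝ, m = (n : ℝ) - k := ⟨_, rfl⟩
  rw [← hm] at hE hQ hB1 ⊢
  have hm2 : 2 ≤ m := by linarith
  have hkm : (k : ℝ) + m = n := by rw [hm]; ring
  generalize (k : ℝ) = κ at *
  generalize (n : ℝ) = N at *
  generalize cusum ξ k = E at *
  generalize |pairStat y k - cusum y k ^ 2| = q at *
  clear hs hkn hk hkn'
  -- square roots
  obtain ⟨a, ha, ha2⟩ : ∃ a : ℝ, a = √κ ∧ a * a = κ := ⟨_, rfl, Real.mul_self_sqrt (by linarith)⟩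
  obtain ⟨b, hb, hb2⟩ : ∃ b : ℝ, b = √m ∧ b * b = m := ⟨_, rfl, Real.mul_self_sqrt (by linarith)⟩
  obtain ⟨c, hc, hc2⟩ : ∃ c : ℝ, c = √N ∧ c * c = N := ⟨_, rfl, Real.mul_self_sqrt (by linarith)⟩
  have ha1 : 1 ≤ a := by rw [ha]; exact Real.one_le_sqrt.2 (by linarith)
  have hb1 : 1 ≤ b := by rw [hb]; exact Real.one_le_sqrt.2 (by linarith)
  have hac : a ≤ c := by rw [ha, hc]; exact Real.sqrt_le_sqrt (by linarith)
  have hbc : b ≤ c := by rw [hb, hc]; exact Real.sqrt_le_sqrt (by linarith)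
  rw [← hc, ← ha, ← hb]
  rw [← hc] at hrN
  have hc0 : 0 ≤ c := by linarith
  have hd0 : 0 ≤ K * r ^ 3 := by positivity
  rw [← ha, ← hb] at hE
  -- Geometric mean of the pointwise and the total bound on the squares. The pointwise bound alone
  -- would leave an average of order r⁴, the size of the threshold; the mean gives r³.
  have hsqrt : ∀ S d : ℝ, 0 ≤ S → 1 ≤ d → S ≤ d * d * (K * r ^ 4) → S ≤ K * N * r ^ 2 →
      S ≤ K * r ^ 3 * (d * c) := by
    intro S d hS hd h1 h2
    refine (sq_le_sq₀ hS (mul_nonneg hd0 (mul_nonneg (by linarith) hc0))).1 ?_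
    calc S ^ 2 = S * S := sq S
      _ ≤ (d * d * (K * r ^ 4)) * (K * N * r ^ 2) := mul_le_mul h1 h2 hS (by positivity)
      _ = (K * r ^ 3 * (d * c)) ^ 2 := by rw [← hc2]; ring
  have hA := hsqrt A a hA0 ha1 (by rw [ha2]; exact hA1) hA2
  have hB := hsqrt B b hB0 hb1 (by rw [hb2]; exact hB1) hB2
  -- Each of κ and m is at least 2, so subtracting 1 loses at most a factor 2.
  have hw : κ * m * N / 4 ≤ (κ - 1) * (m - 1) * N := by
    have h1 : κ * m / 4 ≤ (κ - 1) * (m - 1) := by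
      linarith [mul_nonneg (sub_nonneg.2 hk2) (sub_nonneg.2 hm2)]
    have := mul_le_mul_of_nonneg_right h1 (by linarith : 0 ≤ N)
    linarith
  have hwpos : 0 < κ * m * N / 4 := by positivity
  have hq0 : 0 ≤ E ^ 2 + 2 * N * (m * A + κ * B) := by positivity
  have hE2 : E ^ 2 ≤ 4 * K ^ 2 * (m ^ 2 * (κ * r ^ 2) + m ^ 2 * r ^ 4 + κ ^ 2 * (m * r ^ 2)
      + κ ^ 2 * r ^ 4) := by
    rw [← sq_abs E]
    calc |E| ^ 2 ≤ (m * (K * (r * a + r ^ 2)) + κ * (K * (r * b + r ^ 2))) ^ 2 :=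
          pow_le_pow_left₀ (abs_nonneg _) hE 2
      _ = K ^ 2 * (m * r * a + m * r ^ 2 + κ * r * b + κ * r ^ 2) ^ 2 := by ring
      _ ≤ K ^ 2 * (4 * ((m * r * a) ^ 2 + (m * r ^ 2) ^ 2 + (κ * r * b) ^ 2 + (κ * r ^ 2) ^ 2)) := by
          gcongr
          nlinarith [sq_nonneg (m * r * a - m * r ^ 2), sq_nonneg (m * r * a - κ * r * b),
            sq_nonneg (m * r * a - κ * r ^ 2), sq_nonneg (m * r ^ 2 - κ * r * b),
            sq_nonneg (m * r ^ 2 - κ * r ^ 2), sq_nonneg (κ * r * b - κ * r ^ 2)]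
      _ = _ := by rw [← ha2, ← hb2]; ring
  calc (E ^ 2 + q) / ((κ - 1) * (m - 1) * N)
      ≤ (E ^ 2 + 2 * N * (m * A + κ * B)) / ((κ - 1) * (m - 1) * N) := by
        gcongr
        linarith
    _ ≤ (E ^ 2 + 2 * N * (m * A + κ * B)) / (κ * m * N / 4) := by
        gcongr
    _ ≤ (4 * K ^ 2 * (m ^ 2 * (κ * r ^ 2) + m ^ 2 * r ^ 4 + κ ^ 2 * (m * r ^ 2)
      + κ ^ 2 * r ^ 4) + 2 * N * (m * (K * r ^ 3 * (a * c)) + κ * (K * r ^ 3 * (b * c))))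
        / (κ * m * N / 4) := by
        gcongr
    _ = 16 * K ^ 2 * (r ^ 2 + r ^ 4 * (m / N) / κ + r ^ 4 * (κ / N) / m)
        + 8 * K * (r ^ 3 * c * (1 / a + 1 / b)) := by
        have hκ0 : κ ≠ 0 := by linarith
        have hm0 : m ≠ 0 := by linarith
        have hN0 : N ≠ 0 := by linarith
        have ha0 : a ≠ 0 := by linarith
        have hb0 : b ≠ 0 := by linarith
        rw [← hkm, ← ha2, ← hb2]
        have : a * a + b * b ≠ 0 := by positivity
        field_simp
        ring
    _ ≤ 16 * K ^ 2 * (2 * (r ^ 3 * c * (1 / a + 1 / b)))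
        + 8 * K ^ 2 * (r ^ 3 * c * (1 / a + 1 / b)) := by
        have hnn : ∀ d, 1 ≤ d → d ≤ c → r ^ 2 ≤ r ^ 3 * c * (1 / d) := by
          intro d hd hdc
          have h1 : 1 ≤ c * (1 / d) := by rw [mul_one_div, le_div_iff₀ (by linarith)]; linarith
          calc r ^ 2 = r ^ 2 * 1 * 1 := by ring
            _ ≤ r ^ 2 * r * (c * (1 / d)) := by gcongr
            _ = _ := by ring
        have hfr : ∀ d u, 1 ≤ d → 0 ≤ u → u ≤ N → r ^ 4 * (u / N) / (d * d) ≤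
            r ^ 3 * c * (1 / d) := by
          intro d u hd hu huN
          have h1 : u / N ≤ 1 := by rw [div_le_one (by linarith)]; exact huN
          have h2 : 1 / (d * d) ≤ 1 / d := by
            exact one_div_le_one_div_of_le (by linarith) (le_mul_of_one_le_left (by linarith) hd)
          calc r ^ 4 * (u / N) / (d * d) = r ^ 3 * r * (u / N) * (1 / (d * d)) := by ring
            _ ≤ r ^ 3 * c * 1 * (1 / d) := by
                have : 0 ≤ r ^ 3 * c := by positivity
                gcongr
            _ = _ := by ring
        have f1 := hfr a m ha1 (by linarith) (by linarith)
        have f2 := hfr b κ hb1 (by linarith) (by linarith)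
        have f3 := hnn a ha1 hac
        have f4 := hnn b hb1 hbc
        rw [ha2] at f1
        rw [hb2] at f2
        have f5 : 0 ≤ r ^ 2 := by positivity
        have f6 : 0 ≤ r ^ 3 * c * (1 / a + 1 / b) := by positivity
        have hKK : K ≤ K ^ 2 := le_self_pow₀ hK (by norm_num)
        gcongr
        linarith
    _ = _ := by ring

/-- The inverse square roots sum to at most 4√n, and n - 3 ≥ n/4, so the average is at most 640K²r³
≤ r⁴. -/
lemma NoiseBound.avg_noise_le (h : NoiseBound ξ y K r) (hK : 1 ≤ K) (hr : 1 ≤ r)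
    (hrn : r ^ 4 ≤ n) (hn : 8 ≤ n) (hrK : 640 * K ^ 2 ≤ r) :
    1 / ((n : ℝ) - 3) * ∑ k ∈ Finset.Icc 2 (n - 2),
      (cusum ξ k ^ 2 + |pairStat y k - cusum y k ^ 2|) /
        (((k : ℝ) - 1) * ((n : ℝ) - k - 1) * n) ≤ r ^ 4 := by
  have hn' : (8 : ℝ) ≤ n := by exact_mod_cast hn
  have hsum : ∑ k ∈ Finset.Icc 2 (n - 2),
      (cusum ξ k ^ 2 + |pairStat y k - cusum y k ^ 2|) /
        (((k : ℝ) - 1) * ((n : ℝ) - k - 1) * n) ≤ 40 * K ^ 2 * r ^ 3 * √(n : ℝ) * (4 * √(n : ℝ)) := by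
    refine le_trans (Finset.sum_le_sum fun k hk => ?_) (le_trans (Finset.mul_sum _ _ _).symm.le
      (mul_le_mul_of_nonneg_left (sum_inv_sqrt_add_le n) (by positivity)))
    rw [Finset.mem_Icc] at hk
    exact h.noise_term_le hK hr hrn hk.1 (by omega)
  have hNN : √(n : ℝ) * √(n : ℝ) = n := Real.mul_self_sqrt (by linarith)
  rw [one_div, inv_mul_le_iff₀ (by linarith)]
  calc _ ≤ _ := hsum
    _ = 160 * K ^ 2 * r ^ 3 * (√(n : ℝ) * √(n : ℝ)) := by ring
    _ = (n / 4) * (640 * K ^ 2 * r ^ 3) := by rw [hNN]; ring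
    _ ≤ ((n : ℝ) - 3) * (r * r ^ 3) := by
        refine mul_le_mul (by linarith) (by gcongr) (by positivity) (by linarith)
    _ = _ := by ring

/-- Average of the summands of `D` for a general sequence of observations. -/
noncomputable def avgStat {n : ℕ} (y : Fin n → ℝ) : ℝ :=
  1 / ((n : ℝ) - 3) * ∑ k ∈ Finset.Icc 2 (n - 2),
    pairStat y k / (((k : ℝ) - 1) * ((n : ℝ) - k - 1) * n)

/-- Without a change the CUSUM is pure noise. The `if` with equal branches keeps the shape of the
two-mean decomposition. -/
lemma NoiseBound.avgStat_le (h : NoiseBound ξ y K r) (hK : 1 ≤ K) (hr : 1 ≤ r)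
    (hrn : r ^ 4 ≤ n) (hn : 8 ≤ n) (hrK : 640 * K ^ 2 ≤ r) {k₀ : ℕ} (hk₀ : k₀ ≤ n) {s : ℝ}
    (hy : ∀ i, y i = (if i.val < k₀ then s else s) + ξ i) : avgStat y ≤ r ^ 4 := by
  refine le_trans ?_ (h.avg_noise_le hK hr hrn hn hrK)
  have hn' : (8 : ℝ) ≤ n := by exact_mod_cast hn
  have h3 : (0 : ℝ) ≤ 1 / ((n : ℝ) - 3) := one_div_nonneg.2 (by linarith)
  unfold avgStat
  refine mul_le_mul_of_nonneg_left (Finset.sum_le_sum fun k hk => ?_) h3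
  rw [Finset.mem_Icc] at hk
  have hk2 : (2 : ℝ) ≤ k := by exact_mod_cast hk.1
  have hkn2 : (k : ℝ) + 2 ≤ n := by
    have : k + 2 ≤ n := by omega
    exact_mod_cast this
  have hT : cusum y k = cusum ξ k := by
    have hyf : y = fun i => (if i.val < k₀ then s else s) + ξ i := funext hy
    rw [hyf, cusum_add, cusum_step (by omega) hk₀]; ring
  have hw : 0 ≤ ((k : ℝ) - 1) * ((n : ℝ) - k - 1) * n :=
    mul_nonneg (mul_nonneg (by linarith) (by linarith)) (by linarith)
  refine div_le_div_of_nonneg_right ?_ hw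
  rw [hT]
  linarith [le_abs_self (pairStat y k - cusum ξ k ^ 2)]

/-- With μ = min(k₀, n - k₀), the tent is at least μn/4 for n/4 ≤ k ≤ 3n/4. These k contribute at
least nC²r⁴/32 > 3nr⁴, enough to cover both the noise and the threshold, each (n - 3)r⁴ before
averaging. -/
lemma NoiseBound.lt_avgStat (h : NoiseBound ξ y K r) (hK : 1 ≤ K) (hr : 1 ≤ r)
    (hrn : r ^ 4 ≤ n) (hn : 8 ≤ n) (hrK : 640 * K ^ 2 ≤ r) {k₀ : ℕ} (hk₀ : k₀ < n)
    (hk₀1 : 1 ≤ k₀) {s₁ s₂ C : ℝ} (hC : 10 ≤ C)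
    (hy : ∀ i, y i = (if i.val < k₀ then s₁ else s₂) + ξ i)
    (hs₁ : C * r ^ 2 * n ^ 2 ≤ |s₁ - s₂| * √(n : ℝ) * (k₀ : ℝ) ^ 2)
    (hs₂ : C * r ^ 2 * n ^ 2 ≤ |s₁ - s₂| * √(n : ℝ) * ((n : ℝ) - k₀) ^ 2) :
    r ^ 4 < avgStat y := by
  have hnoise := h.avg_noise_le hK hr hrn hn hrK
  have hn' : (8 : ℝ) ≤ n := by exact_mod_cast hn
  have h3 : (0 : ℝ) < (n : ℝ) - 3 := by linarith
  have hNN : √(n : ℝ) * √(n : ℝ) = n := Real.mul_self_sqrt (by linarith)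
  have hk₀r : (k₀ : ℝ) < n := by exact_mod_cast hk₀
  have hk₀p : (1 : ℝ) ≤ k₀ := by exact_mod_cast hk₀1
  set δ := |s₁ - s₂| with hδ
  have hδ0 : 0 ≤ δ := abs_nonneg _
  obtain ⟨μ, hμ0, hμ1, hμ2, hμ3⟩ : ∃ μ : ℝ, 0 < μ ∧ μ ≤ k₀ ∧ μ ≤ n - k₀ ∧
      C * r ^ 2 * n ^ 2 ≤ δ * √(n : ℝ) * μ ^ 2 := by
    rcases le_total (k₀ : ℝ) ((n : ℝ) - k₀) with hc | hc
    · exact ⟨k₀, by linarith, le_rfl, hc, hs₁⟩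
    · exact ⟨(n : ℝ) - k₀, by linarith, hc, le_rfl, hs₂⟩
  -- the signal in one summand
  have hsig : C ^ 2 * r ^ 4 * n ≤ δ ^ 2 * μ ^ 2 := by
    have h1 : (C * r ^ 2 * n ^ 2) ^ 2 ≤ (δ * √(n : ℝ) * μ ^ 2) ^ 2 :=
      pow_le_pow_left₀ (by positivity) hμ3 2
    have h2 : μ ^ 2 ≤ (n : ℝ) ^ 2 := pow_le_pow_left₀ hμ0.le (by linarith) 2
    have h4 : C ^ 2 * r ^ 4 * n * (n : ℝ) ^ 3 ≤ δ ^ 2 * μ ^ 2 * (n : ℝ) ^ 3 := by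
      calc C ^ 2 * r ^ 4 * n * (n : ℝ) ^ 3 = (C * r ^ 2 * n ^ 2) ^ 2 := by ring
        _ ≤ _ := h1
        _ = δ ^ 2 * μ ^ 2 * μ ^ 2 * (√(n : ℝ) * √(n : ℝ)) := by ring
        _ = δ ^ 2 * μ ^ 2 * μ ^ 2 * n := by rw [hNN]
        _ ≤ δ ^ 2 * μ ^ 2 * n ^ 2 * n := by gcongr
        _ = _ := by ring
    exact le_of_mul_le_mul_right h4 (by positivity)
  have hterm : ∀ k ∈ Finset.Icc 2 (n - 2),
      (δ * ((n : ℝ) * (min k k₀ : ℕ) - k * k₀)) ^ 2 / (2 * (k * ((n : ℝ) - k) * n)) -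
        (cusum ξ k ^ 2 + |pairStat y k - cusum y k ^ 2|) /
          (((k : ℝ) - 1) * ((n : ℝ) - k - 1) * n) ≤
      pairStat y k / (((k : ℝ) - 1) * ((n : ℝ) - k - 1) * n) := by
    intro k hk
    rw [Finset.mem_Icc] at hk
    have hk2 : (2 : ℝ) ≤ k := by exact_mod_cast hk.1
    have hkn2 : (k : ℝ) + 2 ≤ n := by
      have : k + 2 ≤ n := by omega
      exact_mod_cast this
    have hT : cusum y k = (s₁ - s₂) * ((n : ℝ) * (min k k₀ : ℕ) - k * k₀) + cusum ξ k := by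
      have hyf : y = fun i => (if i.val < k₀ then s₁ else s₂) + ξ i := funext hy
      rw [hyf, cusum_add, cusum_step (by omega) hk₀.le]
    have hw : 0 < ((k : ℝ) - 1) * ((n : ℝ) - k - 1) * n :=
      mul_pos (mul_pos (by linarith) (by linarith)) (by linarith)
    have hww : ((k : ℝ) - 1) * ((n : ℝ) - k - 1) * n ≤ k * ((n : ℝ) - k) * n :=
      mul_le_mul_of_nonneg_right (mul_le_mul (by linarith) (by linarith) (by linarith)
        (by linarith)) (by linarith)
    -- This is (u + e)² ≥ u²/2 - e², a rearrangement of (u + 2e)² ≥ 0.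
    have hsq : (δ * ((n : ℝ) * (min k k₀ : ℕ) - k * k₀)) ^ 2 / 2 - cusum ξ k ^ 2 ≤
        cusum y k ^ 2 := by
      rw [hT, mul_pow, hδ, sq_abs, ← mul_pow]
      linarith [sq_nonneg ((s₁ - s₂) * ((n : ℝ) * (min k k₀ : ℕ) - k * k₀) + 2 * cusum ξ k)]
    have hle : (δ * ((n : ℝ) * (min k k₀ : ℕ) - k * k₀)) ^ 2 / (2 * (k * ((n : ℝ) - k) * n)) ≤
        (δ * ((n : ℝ) * (min k k₀ : ℕ) - k * k₀)) ^ 2 / 2 /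
          (((k : ℝ) - 1) * ((n : ℝ) - k - 1) * n) := by
      rw [← div_div]
      gcongr
    refine le_trans (sub_le_sub_right hle _) ?_
    rw [← sub_div]
    refine div_le_div_of_nonneg_right ?_ hw.le
    linarith [neg_abs_le (pairStat y k - cusum y k ^ 2)]
  have hmain : (n : ℝ) / 4 * (C ^ 2 * r ^ 4 / 8) ≤ ∑ k ∈ Finset.Icc 2 (n - 2),
      (δ * ((n : ℝ) * (min k k₀ : ℕ) - k * k₀)) ^ 2 / (2 * (k * ((n : ℝ) - k) * n)) := by
    -- The lower end is n/4 rounded up; n ≥ 8 gives the inclusion.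
    have hsub : Finset.Icc ((n + 3) / 4) (3 * n / 4) ⊆ Finset.Icc 2 (n - 2) := by
      intro k; simp only [Finset.mem_Icc]; omega
    have hnn : ∀ k ∈ Finset.Icc 2 (n - 2), 0 ≤
        (δ * ((n : ℝ) * (min k k₀ : ℕ) - k * k₀)) ^ 2 / (2 * (k * ((n : ℝ) - k) * n)) := by
      intro k hk
      rw [Finset.mem_Icc] at hk
      have : (0 : ℝ) ≤ (n : ℝ) - k := by
        have : (k : ℝ) ≤ n := by exact_mod_cast (by omega : k ≤ n)
        linarith
      positivity
    refine le_trans ?_ (Finset.sum_le_sum_of_subset_of_nonneg hsub fun k hk _ => hnn k hk)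
    have hcard : (n : ℝ) / 4 ≤ (Finset.Icc ((n + 3) / 4) (3 * n / 4)).card := by
      rw [Nat.card_Icc, div_le_iff₀ (by norm_num)]
      exact_mod_cast (by omega : n ≤ (3 * n / 4 + 1 - (n + 3) / 4) * 4)
    refine le_trans (mul_le_mul_of_nonneg_right hcard (by positivity)) ?_
    rw [← nsmul_eq_mul]
    refine Finset.card_nsmul_le_sum _ _ _ fun k hk => ?_
    rw [Finset.mem_Icc] at hk
    have hk1 : (n : ℝ) ≤ 4 * k := by exact_mod_cast (by omega : n ≤ 4 * k)
    have hk2 : 4 * (k : ℝ) ≤ 3 * n := by exact_mod_cast (by omega : 4 * k ≤ 3 * n)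
    have hH : μ * n / 4 ≤ (n : ℝ) * (min k k₀ : ℕ) - k * k₀ := by
      rcases le_total k k₀ with hc | hc
      · rw [min_eq_left hc]
        have : (n : ℝ) / 4 * μ ≤ k * (n - k₀) := by
          apply mul_le_mul <;> linarith
        linarith
      · rw [min_eq_right hc]
        have : μ * ((n : ℝ) / 4) ≤ k₀ * (n - k) := by
          apply mul_le_mul <;> linarith
        linarith
    have hkm : k * ((n : ℝ) - k) ≤ (n : ℝ) ^ 2 / 4 := by linarith [sq_nonneg ((n : ℝ) - 2 * k)]
    have hkmpos : 0 < k * ((n : ℝ) - k) := mul_pos (by linarith) (by linarith)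
    rw [le_div_iff₀ (by positivity)]
    calc C ^ 2 * r ^ 4 / 8 * (2 * (k * ((n : ℝ) - k) * n))
        ≤ C ^ 2 * r ^ 4 / 8 * (2 * ((n : ℝ) ^ 2 / 4 * n)) := by gcongr
      _ = (C ^ 2 * r ^ 4 * n) * (n ^ 2 / 16) := by ring
      _ ≤ (δ ^ 2 * μ ^ 2) * (n ^ 2 / 16) := by gcongr
      _ = (δ * (μ * n / 4)) ^ 2 := by ring
      _ ≤ _ := by gcongr
  have hfin := Finset.sum_le_sum hterm
  rw [Finset.sum_sub_distrib] at hfin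
  unfold avgStat
  rw [one_div, inv_mul_le_iff₀ h3] at hnoise
  rw [one_div, lt_inv_mul_iff₀ h3]
  have hC2 : 100 * r ^ 4 ≤ C ^ 2 * r ^ 4 := by
    gcongr
    linarith [pow_le_pow_left₀ (by norm_num) hC 2]
  have hr4 : 0 < r ^ 4 := by positivity
  have hn4 := mul_le_mul_of_nonneg_left hC2 (by linarith : (0 : ℝ) ≤ n)
  have hn5 : 0 ≤ (n : ℝ) * r ^ 4 := by positivity
  linarith

end

end CovChangePoint

namespace CovChangePoint

/-! ### From centered observations to the noise of the outer products -/

/-- The covariance matrix of the `i`-th observation. -/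
def covAt {n p : ℕ} (S₁ S₂ : Matrix (Fin p) (Fin p) ℝ) (k₀ : ℕ) (i : Fin n) (a b : Fin p) : ℝ :=
  if i.val < k₀ then S₁ a b else S₂ a b

/-- Bounds on a sample `z` of centered observations at noise level `r`. -/
structure GoodSample {n p : ℕ} (z : Fin n → Fin p → ℝ) (S₁ S₂ : Matrix (Fin p) (Fin p) ℝ)
    (k₀ : ℕ) (K r : ℝ) : Prop where
  first : ∀ a, ∀ k ≤ n, |∑ i ∈ firstIdx n k, z i a| ≤ K * (r * √(k : ℝ) + r ^ 2)
  last : ∀ a, ∀ k ≤ n, |∑ i ∈ lastIdx n k, z i a| ≤ K * (r * √((n : ℝ) - k) + r ^ 2)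
  first_mul : ∀ a b, ∀ k ≤ n, |∑ i ∈ firstIdx n k, (z i a * z i b - covAt S₁ S₂ k₀ i a b)| ≤
    K * (r * √(k : ℝ) + r ^ 2)
  last_mul : ∀ a b, ∀ k ≤ n, |∑ i ∈ lastIdx n k, (z i a * z i b - covAt S₁ S₂ k₀ i a b)| ≤
    K * (r * √((n : ℝ) - k) + r ^ 2)
  abs_apply_le : ∀ i a, |z i a| ≤ K * r

/-- The common mean cancels, so the true-mean-centred sample z may be analysed instead. -/
lemma centered_add_const {n p : ℕ} (hn : 1 ≤ n) (z : Fin n → Fin p → ℝ) (m : Fin p → ℝ) (i : Fin n)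
    (a : Fin p) : centered (fun i a => z i a + m a) i a = z i a - sampleMean z a := by
  have hn' : (n : ℝ) ≠ 0 := by positivity
  simp only [centered, sampleMean, Finset.sum_add_distrib, Finset.sum_const, Finset.card_univ,
    Fintype.card_fin, nsmul_eq_mul]
  field_simp
  ring

section

variable {n p : ℕ} {z : Fin n → Fin p → ℝ} {S₁ S₂ : Matrix (Fin p) (Fin p) ℝ} {k₀ : ℕ} {K r M : ℝ}

lemma firstIdx_self (n : ℕ) : firstIdx n n = Finset.univ := by
  ext i; simp [firstIdx]

lemma GoodSample.abs_sampleMean_le (h : GoodSample z S₁ S₂ k₀ K r) (hK : 1 ≤ K) (hr : 1 ≤ r)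
    (hrn : r ^ 4 ≤ n) (a : Fin p) : |sampleMean z a| ≤ 2 * K * r / √(n : ℝ) := by
  obtain ⟨hrN, hn1⟩ := pow_four_le_cast_imp hr hrn
  have hN : 0 < √(n : ℝ) := by linarith
  have hNN : √(n : ℝ) * √(n : ℝ) = n := Real.mul_self_sqrt (by linarith)
  have h1 := h.first a n le_rfl
  rw [firstIdx_self] at h1
  have h2 : r ^ 2 ≤ r * √(n : ℝ) := by rw [sq]; gcongr
  rw [sampleMean, abs_div, abs_of_nonneg (by linarith : (0 : ℝ) ≤ n), div_le_div_iff₀ (by linarith) hN]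
  calc |∑ i, z i a| * √(n : ℝ) ≤ (K * (r * √(n : ℝ) + r * √(n : ℝ))) * √(n : ℝ) := by
        gcongr
        exact h1.trans (by gcongr)
    _ = 2 * K * r * (√(n : ℝ) * √(n : ℝ)) := by ring
    _ = _ := by rw [hNN]

/-- Sample means are O(r/√n), hence at most 2K. Expanding the product, the four terms cost K², 2K²,
2K² and 4K², whence the 9. -/
lemma GoodSample.abs_sum_le (h : GoodSample z S₁ S₂ k₀ K r) (hK : 1 ≤ K) (hr : 1 ≤ r)
    (hrn : r ^ 4 ≤ n) (a b : Fin p) (I : Finset (Fin n)) {s : ℝ} (hs : 0 ≤ s)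
    (ha : |∑ i ∈ I, z i a| ≤ K * (r * s + r ^ 2)) (hb : |∑ i ∈ I, z i b| ≤ K * (r * s + r ^ 2))
    (hab : |∑ i ∈ I, (z i a * z i b - covAt S₁ S₂ k₀ i a b)| ≤ K * (r * s + r ^ 2)) :
    |∑ i ∈ I, ((z i a - sampleMean z a) * (z i b - sampleMean z b) - covAt S₁ S₂ k₀ i a b)| ≤
      9 * K ^ 2 * (r * s + r ^ 2) := by
  obtain ⟨hrN, hn1⟩ := pow_four_le_cast_imp hr hrn
  have hN : 0 < √(n : ℝ) := by linarith
  have hNN : √(n : ℝ) * √(n : ℝ) = n := Real.mul_self_sqrt (by linarith)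
  have hma := h.abs_sampleMean_le hK hr hrn a
  have hmb := h.abs_sampleMean_le hK hr hrn b
  have hle : 2 * K * r / √(n : ℝ) ≤ 2 * K := by
    rw [div_le_iff₀ hN]; gcongr
  have hcard : (I.card : ℝ) ≤ n := by
    have := Finset.card_le_univ I
    rw [Fintype.card_fin] at this
    exact_mod_cast this
  set u := sampleMean z a
  set v := sampleMean z b
  have heq : ∑ i ∈ I, ((z i a - u) * (z i b - v) - covAt S₁ S₂ k₀ i a b) =
      (∑ i ∈ I, (z i a * z i b - covAt S₁ S₂ k₀ i a b)) - u * (∑ i ∈ I, z i b)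
        - v * (∑ i ∈ I, z i a) + I.card * (u * v) := by
    rw [Finset.mul_sum, Finset.mul_sum, ← nsmul_eq_mul, ← Finset.sum_const,
      ← Finset.sum_sub_distrib, ← Finset.sum_sub_distrib, ← Finset.sum_add_distrib]
    exact Finset.sum_congr rfl fun i _ => by ring
  rw [heq]
  have hB : 0 ≤ r * s + r ^ 2 := by positivity
  have t1 : |u * ∑ i ∈ I, z i b| ≤ 2 * K * (K * (r * s + r ^ 2)) := by
    rw [abs_mul]
    exact mul_le_mul (hma.trans hle) hb (abs_nonneg _) (by positivity)
  have t2 : |v * ∑ i ∈ I, z i a| ≤ 2 * K * (K * (r * s + r ^ 2)) := by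
    rw [abs_mul]
    exact mul_le_mul (hmb.trans hle) ha (abs_nonneg _) (by positivity)
  have t3 : |(I.card : ℝ) * (u * v)| ≤ 4 * K ^ 2 * r ^ 2 := by
    rw [abs_mul, abs_mul, Nat.abs_cast]
    calc (I.card : ℝ) * (|u| * |v|) ≤ n * ((2 * K * r / √(n : ℝ)) * (2 * K * r / √(n : ℝ))) := by
          gcongr
      _ = 4 * K ^ 2 * r ^ 2 * (n / (√(n : ℝ) * √(n : ℝ))) := by field_simp; ring
      _ = _ := by rw [hNN, div_self (by linarith), mul_one]
  have hKK : K * (r * s + r ^ 2) ≤ K ^ 2 * (r * s + r ^ 2) := by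
    gcongr; exact le_self_pow₀ hK (by norm_num)
  have hrs : 0 ≤ K ^ 2 * (r * s) := by positivity
  calc _ ≤ |∑ i ∈ I, (z i a * z i b - covAt S₁ S₂ k₀ i a b)| + |u * ∑ i ∈ I, z i b|
        + |v * ∑ i ∈ I, z i a| + |(I.card : ℝ) * (u * v)| :=
        (abs_add_le _ _).trans (add_le_add_left ((abs_sub _ _).trans
          (add_le_add_left (abs_sub _ _) _)) _)
    _ ≤ _ := by linarith [mul_nonneg (by positivity : 0 ≤ K ^ 2) (sq_nonneg r)]

/-- Centred coordinates are at most 3Kr, which gives 81K⁴r⁴ for a squared product. In the sum of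
squares one factor |y| is bounded by 9K²r², and the other is averaged through sums of squared
coordinates of size n(M + 18K²); this is why r² appears there and not r⁴. -/
lemma GoodSample.noiseBound (h : GoodSample z S₁ S₂ k₀ K r) (hK : 1 ≤ K) (hr : 1 ≤ r)
    (hrn : r ^ 4 ≤ n) (hM : 0 ≤ M) (hS₁ : ∀ a, S₁ a a ≤ M) (hS₂ : ∀ a, S₂ a a ≤ M) (a b : Fin p) :
    NoiseBound
      (fun i => (z i a - sampleMean z a) * (z i b - sampleMean z b) - covAt S₁ S₂ k₀ i a b)
      (fun i => (z i a - sampleMean z a) * (z i b - sampleMean z b))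
      (9 * K ^ 2 * (M + 18 * K ^ 2) + 81 * K ^ 4) r := by
  obtain ⟨hrN, hn1⟩ := pow_four_le_cast_imp hr hrn
  have hN : 0 < √(n : ℝ) := by linarith
  have hNN : √(n : ℝ) * √(n : ℝ) = n := Real.mul_self_sqrt (by linarith)
  have hKK : 1 ≤ K ^ 2 := one_le_pow₀ hK
  have hKM : 0 ≤ K ^ 2 * M := by positivity
  have hK4 : 0 ≤ K ^ 4 := by positivity
  have hK24 : K ^ 2 ≤ K ^ 4 := pow_le_pow_right₀ hK (by norm_num)
  have hlarge : 9 * K ^ 2 ≤ 9 * K ^ 2 * (M + 18 * K ^ 2) + 81 * K ^ 4 := by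
    linarith
  have hfirst : ∀ a b, ∀ k ≤ n, |∑ i ∈ firstIdx n k,
      ((z i a - sampleMean z a) * (z i b - sampleMean z b) - covAt S₁ S₂ k₀ i a b)| ≤
        9 * K ^ 2 * (r * √(k : ℝ) + r ^ 2) := fun a b k hk =>
    h.abs_sum_le hK hr hrn a b _ (Real.sqrt_nonneg _) (h.first a k hk) (h.first b k hk)
      (h.first_mul a b k hk)
  have hz : ∀ i a, |z i a - sampleMean z a| ≤ 3 * K * r := by
    intro i a
    have h1 := h.abs_sampleMean_le hK hr hrn a
    have h2 : 2 * K * r / √(n : ℝ) ≤ 2 * K * r := div_le_self (by positivity) (hr.trans hrN)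
    have h3 := abs_sub (z i a) (sampleMean z a)
    linarith [h.abs_apply_le i a]
  have hy : ∀ i, |(z i a - sampleMean z a) * (z i b - sampleMean z b)| ≤ 9 * K ^ 2 * r ^ 2 := by
    intro i
    rw [abs_mul]
    calc _ ≤ (3 * K * r) * (3 * K * r) :=
          mul_le_mul (hz i a) (hz i b) (abs_nonneg _) (by positivity)
      _ = _ := by ring
  have hsq : ∀ a, ∑ i, (z i a - sampleMean z a) ^ 2 ≤ n * (M + 18 * K ^ 2) := by
    intro a
    have h1 := (abs_le.1 (hfirst a a n le_rfl)).2
    rw [firstIdx_self, Finset.sum_sub_distrib] at h1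
    have h2 : ∑ i : Fin n, covAt S₁ S₂ k₀ i a a ≤ n * M := by
      have := Finset.sum_le_card_nsmul (Finset.univ : Finset (Fin n))
        (fun i => covAt S₁ S₂ k₀ i a a) M (fun i _ => by
          unfold covAt; split_ifs; exacts [hS₁ a, hS₂ a])
      simpa using this
    have h3 : r * √(n : ℝ) + r ^ 2 ≤ 2 * n := by
      have h4 : r * √(n : ℝ) ≤ n := (mul_le_mul_of_nonneg_right hrN hN.le).trans hNN.le
      have h5 : r ^ 2 ≤ n := (pow_le_pow_right₀ hr (by norm_num)).trans hrn
      linarith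
    have h4 : 9 * K ^ 2 * (r * √(n : ℝ) + r ^ 2) ≤ 9 * K ^ 2 * (2 * n) := by gcongr
    simp_rw [sq (_ - _)]
    linarith
  refine ⟨fun k hk => (hfirst a b k hk).trans (by gcongr), fun k hk => ?_, fun i => ?_, ?_⟩
  · refine (h.abs_sum_le hK hr hrn a b _ (Real.sqrt_nonneg _) (h.last a k hk) (h.last b k hk)
      (h.last_mul a b k hk)).trans ?_
    gcongr
  · rw [← sq_abs]
    calc _ ≤ (9 * K ^ 2 * r ^ 2) ^ 2 := pow_le_pow_left₀ (abs_nonneg _) (hy i) 2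
      _ = 81 * K ^ 4 * r ^ 4 := by ring
      _ ≤ _ := by
        gcongr
        have : 0 ≤ 9 * K ^ 2 * (M + 18 * K ^ 2) := by positivity
        linarith
  · calc ∑ i, ((z i a - sampleMean z a) * (z i b - sampleMean z b)) ^ 2
        ≤ ∑ i, (9 * K ^ 2 * r ^ 2) *
          ((z i a - sampleMean z a) ^ 2 / 2 + (z i b - sampleMean z b) ^ 2 / 2) := by
          refine Finset.sum_le_sum fun i _ => ?_
          rw [← sq_abs, sq]
          refine mul_le_mul (hy i) ?_ (abs_nonneg _) (by positivity)
          rw [abs_le]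
          constructor
          · linarith [sq_nonneg ((z i a - sampleMean z a) + (z i b - sampleMean z b))]
          · linarith [sq_nonneg ((z i a - sampleMean z a) - (z i b - sampleMean z b))]
      _ = (9 * K ^ 2 * r ^ 2) * ((∑ i, (z i a - sampleMean z a) ^ 2) / 2 +
          (∑ i, (z i b - sampleMean z b) ^ 2) / 2) := by
          rw [← Finset.mul_sum, Finset.sum_add_distrib, Finset.sum_div, Finset.sum_div]
      _ ≤ (9 * K ^ 2 * r ^ 2) * (n * (M + 18 * K ^ 2) / 2 + n * (M + 18 * K ^ 2) / 2) := by
          gcongr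
          exacts [hsq a, hsq b]
      _ = (9 * K ^ 2 * (M + 18 * K ^ 2)) * n * r ^ 2 := by ring
      _ ≤ _ := by
          gcongr
          have : 0 ≤ 81 * K ^ 4 := by positivity
          linarith

/-- On a good sample every maximizer of `U` is close to the change point. -/
theorem GoodSample.dist_lt (h : GoodSample z S₁ S₂ k₀ K r) (hK : 1 ≤ K) (hr : 1 ≤ r)
    (hrn : r ^ 4 ≤ n) (hn : 8 ≤ n) (hk₀ : 1 ≤ k₀) (hk₀n : k₀ < n) (hM : 0 ≤ M)
    (hS₁ : ∀ a, S₁ a a ≤ M) (hS₂ : ∀ a, S₂ a a ≤ M)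
    {L C ε : ℝ} (hL : L = 9 * K ^ 2 * (M + 18 * K ^ 2) + 81 * K ^ 4)
    (hrL : 640 * L ^ 2 ≤ r) (hε : 0 < ε) (hrε : 8 * L ≤ ε * r) (hC : 10 ≤ C)
    (hne : ∃ a b, a ≤ b ∧ S₁ a b ≠ S₂ a b)
    (hs₁ : ∀ a b, S₁ a b ≠ S₂ a b →
      C * r ^ 2 * n ^ 2 ≤ |S₁ a b - S₂ a b| * √(n : ℝ) * (k₀ : ℝ) ^ 2)
    (hs₂ : ∀ a b, S₁ a b ≠ S₂ a b →
      C * r ^ 2 * n ^ 2 ≤ |S₁ a b - S₂ a b| * √(n : ℝ) * ((n : ℝ) - k₀) ^ 2)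
    {m : Fin p → ℝ} {k : ℕ} (hk : IsArgmaxU (fun i a => z i a + m a) (r ^ 4) k) :
    |(k : ℝ) / k₀ - 1| < ε := by
  by_contra hcon
  rw [not_lt] at hcon
  have hk₀p : (0 : ℝ) < k₀ := by exact_mod_cast hk₀
  have hdist : ε * k₀ ≤ |(k : ℝ) - k₀| := by
    have : |(k : ℝ) - k₀| = |(k : ℝ) / k₀ - 1| * k₀ := by
      rw [← abs_of_pos hk₀p, ← abs_mul, abs_of_pos hk₀p, sub_mul,
        div_mul_cancel₀ _ hk₀p.ne', one_mul]
    rw [this]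
    gcongr
  obtain ⟨hkmem, hkmax⟩ := hk
  rw [Finset.mem_Icc] at hkmem
  have hmax := hkmax k₀ (Finset.mem_Icc.2 ⟨hk₀, hk₀n.le⟩)
  refine absurd hmax (not_le.2 ?_)
  set x : Fin n → Fin p → ℝ := fun i a => z i a + m a with hx
  have hL1 : 1 ≤ L := by
    have h1 : 1 ≤ K ^ 4 := one_le_pow₀ hK
    have h2 : 0 ≤ 9 * K ^ 2 * (M + 18 * K ^ 2) := by positivity
    rw [hL]; linarith
  have hy : ∀ a b, (fun i => outerEntry x i a b) =
      fun i => (z i a - sampleMean z a) * (z i b - sampleMean z b) := by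
    intro a b
    funext i
    rw [outerEntry, hx, centered_add_const (by omega), centered_add_const (by omega)]
  have hnb := fun a b => h.noiseBound hK hr hrn hM hS₁ hS₂ a b
  simp_rw [← hL, ← hy] at hnb
  have hdec : ∀ a b (i : Fin n), outerEntry x i a b = (if i.val < k₀ then S₁ a b else S₂ a b) +
      ((z i a - sampleMean z a) * (z i b - sampleMean z b) - covAt S₁ S₂ k₀ i a b) := by
    intro a b i
    rw [congrFun (hy a b) i, covAt]; ring
  have hD : ∀ a b, D x a b = avgStat (fun i => outerEntry x i a b) := fun a b =>
    D_eq_sum_pairStat x a b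
  have hkept : ∀ q ∈ kept x (r ^ 4), S₁ q.1 q.2 ≠ S₂ q.1 q.2 := by
    intro q hq heq
    rw [kept, Finset.mem_filter] at hq
    refine absurd hq.2.2 (not_lt.2 ?_)
    rw [hD]
    refine (hnb q.1 q.2).avgStat_le hL1 hr hrn hn hrL hk₀n.le (s := S₂ q.1 q.2) fun i => ?_
    rw [hdec, heq]
  -- If nothing survived, `U` would vanish identically and every k would be a maximizer.
  have hnonempty : (kept x (r ^ 4)).Nonempty := by
    obtain ⟨a, b, hab, hneq⟩ := hne
    refine ⟨(a, b), ?_⟩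
    rw [kept, Finset.mem_filter]
    refine ⟨Finset.mem_univ _, hab, ?_⟩
    rw [hD]
    exact (hnb a b).lt_avgStat hL1 hr hrn hn hrL hk₀n hk₀ hC (hdec a b) (hs₁ a b hneq)
      (hs₂ a b hneq)
  rw [U_eq_sum_pairStat, U_eq_sum_pairStat]
  have hn4 : (0 : ℝ) < 1 / (n : ℝ) ^ 4 := by
    have : (0 : ℝ) < n := by exact_mod_cast (by omega : 0 < n)
    positivity
  refine mul_lt_mul_of_pos_left (Finset.sum_lt_sum_of_nonempty hnonempty fun q hq => ?_) hn4
  exact (hnb q.1 q.2).pairStat_lt hL1 hr hrn hkmem.2 hk₀n.le (by linarith : 1 ≤ C) hε hrε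
    (hdec q.1 q.2) (hs₁ _ _ (hkept q hq)) (hs₂ _ _ (hkept q hq)) hdist

end

end CovChangePoint

namespace CovChangePoint

/-! ### Exponential moments and concentration -/

section

variable {Ω : Type u} [MeasurableSpace Ω] {P : Measure Ω} [IsProbabilityMeasure P]

/-- The linear term integrates to zero for a centred variable, leaving a quadratic bound on the
moment generating function. -/
lemma exp_le_one_add_add_sq_mul_exp_abs (x : ℝ) :
    Real.exp x ≤ 1 + x + x ^ 2 * Real.exp |x| := by
  have h0 : 1 ≤ Real.exp |x| := Real.one_le_exp (abs_nonneg x)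
  have h2 : x ^ 2 ≤ x ^ 2 * Real.exp |x| := le_mul_of_one_le_right (sq_nonneg x) h0
  rcases le_or_gt |x| 1 with h | h
  · have := (abs_le.1 (Real.abs_exp_sub_one_sub_id_le h)).2
    linarith
  · rcases le_total 0 x with hx | hx
    · rw [abs_of_nonneg hx] at h ⊢
      have : Real.exp x ≤ x ^ 2 * Real.exp x :=
        le_mul_of_one_le_left (Real.exp_pos x).le (one_le_pow₀ h.le)
      linarith
    · rw [abs_of_nonpos hx] at h
      have : Real.exp x ≤ 1 := Real.exp_le_one_iff.2 hx
      nlinarith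

/-- A Gaussian tail bound gives an exponential moment of the square. -/
lemma integral_exp_sq_le {X : Ω → ℝ} (hX : Measurable X) {c₁ c₂ : ℝ} (hc₁ : 0 < c₁) (hc₂ : 0 < c₂)
    (htail : ∀ t : ℝ, 0 < t → P.real {ω | t < |X ω|} ≤ c₁ * Real.exp (-c₂ * t ^ 2)) :
    Integrable (fun ω => Real.exp (c₂ / 2 * X ω ^ 2)) P ∧
      ∫ ω, Real.exp (c₂ / 2 * X ω ^ 2) ∂P ≤ 1 + c₁ := by
  set f : Ω → ℝ := fun ω => Real.exp (c₂ / 2 * X ω ^ 2) with hf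
  have hfm : Measurable f := by fun_prop
  have hf0 : 0 ≤ᵐ[P] f := ae_of_all _ fun ω => (Real.exp_pos _).le
  have hl : ∫⁻ ω, ENNReal.ofReal (f ω) ∂P ≤ ENNReal.ofReal (1 + c₁) := by
    rw [lintegral_eq_lintegral_meas_lt P hf0 hfm.aemeasurable,
      ← Set.Ioc_union_Ioi_eq_Ioi (zero_le_one (α := ℝ)),
      lintegral_union measurableSet_Ioi (Set.Ioc_disjoint_Ioi le_rfl),
      ENNReal.ofReal_add zero_le_one hc₁.le]
    refine add_le_add ?_ ?_
    · calc ∫⁻ t in Set.Ioc (0 : ℝ) 1, P {a | t < f a} ≤ ∫⁻ _ in Set.Ioc (0 : ℝ) 1, 1 :=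
            lintegral_mono fun t => prob_le_one
        _ = ENNReal.ofReal 1 := by simp
    -- Layer cake above level 1: the exponent c₂/2 is half the tail rate, so the level-t tail is at
    -- most c₁t⁻², whose integral is c₁.
    · have hint := integral_Ioi_rpow_of_lt (a := -2) (by norm_num) (zero_lt_one (α := ℝ))
      have hio := integrableOn_Ioi_rpow_of_lt (a := -2) (by norm_num) (zero_lt_one (α := ℝ))
      calc ∫⁻ t in Set.Ioi (1 : ℝ), P {a | t < f a}
          ≤ ∫⁻ t in Set.Ioi (1 : ℝ), ENNReal.ofReal (c₁ * t ^ (-2 : ℝ)) := by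
            refine setLIntegral_mono' measurableSet_Ioi fun t ht => ?_
            rw [Set.mem_Ioi] at ht
            have hlog : 0 < Real.log t := Real.log_pos ht
            have hs : 0 < 2 * Real.log t / c₂ := by positivity
            have h1 := htail (√(2 * Real.log t / c₂)) (Real.sqrt_pos.2 hs)
            rw [Real.sq_sqrt hs.le] at h1
            have h2 : c₁ * Real.exp (-c₂ * (2 * Real.log t / c₂)) = c₁ * t ^ (-2 : ℝ) := by
              rw [Real.rpow_def_of_pos (by linarith)]
              congr 2
              field_simp
            rw [h2] at h1
            have h3 : {a | t < f a} = {ω | √(2 * Real.log t / c₂) < |X ω|} := by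
              ext ω
              simp only [Set.mem_ofPred_eq, hf]
              rw [← Real.log_lt_iff_lt_exp (by linarith), ← Real.sqrt_sq_eq_abs,
                Real.sqrt_lt_sqrt_iff hs.le, div_lt_iff₀ hc₂]
              constructor <;> intro h <;> linarith
            rw [h3, ← ofReal_measureReal]
            exact ENNReal.ofReal_le_ofReal h1
        _ = ENNReal.ofReal (∫ t in Set.Ioi (1 : ℝ), c₁ * t ^ (-2 : ℝ)) := by
            rw [ofReal_integral_eq_lintegral_ofReal (hio.const_mul c₁)]
            filter_upwards [ae_restrict_mem measurableSet_Ioi] with t ht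
            rw [Set.mem_Ioi] at ht
            have : 0 < t := by linarith
            positivity
        _ = ENNReal.ofReal c₁ := by
            rw [integral_const_mul, hint]; norm_num
  have hi : Integrable f P := by
    refine ⟨hfm.aestronglyMeasurable, ?_⟩
    rw [hasFiniteIntegral_iff_ofReal hf0]
    exact hl.trans_lt ENNReal.ofReal_lt_top
  refine ⟨hi, ?_⟩
  rw [← ENNReal.ofReal_le_ofReal_iff (by linarith), ofReal_integral_eq_lintegral_ofReal hi hf0]
  exact hl

/-- The exponential moment of the square of a centered variable. -/
lemma integral_exp_sq_sub_mean_le {X : Ω → ℝ} (hX : Measurable X) (hX2 : MemLp X 2 P) {c₁ c₂ : ℝ}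
    (hc₁ : 0 < c₁) (hc₂ : 0 < c₂)
    (htail : ∀ t : ℝ, 0 < t → P.real {ω | t < |X ω|} ≤ c₁ * Real.exp (-c₂ * t ^ 2))
    {m : ℝ} (hm : ∫ ω, X ω ∂P = m) :
    Integrable (fun ω => Real.exp (c₂ / 4 * (X ω - m) ^ 2)) P ∧
      ∫ ω, Real.exp (c₂ / 4 * (X ω - m) ^ 2) ∂P ≤ (1 + c₁) * Real.exp c₁ := by
  obtain ⟨hi, hle⟩ := integral_exp_sq_le hX hc₁ hc₂ htail
  -- From m² ≤ E X² and x ≤ exp x - 1. Together with (X - m)² ≤ 2X² + 2m² it explains the halved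
  -- exponent and the factor exp c₁.
  have hm2 : c₂ / 2 * m ^ 2 ≤ c₁ := by
    have hv := variance_nonneg X P
    rw [variance_eq_sub hX2, hm] at hv
    have hsq : c₂ / 2 * ∫ ω, X ω ^ 2 ∂P ≤ ∫ ω, (Real.exp (c₂ / 2 * X ω ^ 2) - 1) ∂P := by
      rw [← integral_const_mul]
      refine integral_mono (hX2.integrable_sq.const_mul _) (hi.sub (integrable_const 1)) fun ω => ?_
      have := Real.add_one_le_exp (c₂ / 2 * X ω ^ 2)
      simp only
      linarith
    rw [integral_sub hi (integrable_const 1)] at hsq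
    simp only [integral_const, probReal_univ, one_smul] at hsq
    have : m ^ 2 ≤ ∫ ω, X ω ^ 2 ∂P := by simpa using hv
    have h2 : c₂ / 2 * m ^ 2 ≤ c₂ / 2 * ∫ ω, X ω ^ 2 ∂P := by gcongr
    linarith
  have hpt : ∀ ω, Real.exp (c₂ / 4 * (X ω - m) ^ 2) ≤
      Real.exp (c₂ / 2 * X ω ^ 2) * Real.exp c₁ := by
    intro ω
    rw [← Real.exp_add]
    refine Real.exp_le_exp.2 ?_
    have := mul_nonneg hc₂.le (sq_nonneg (X ω + m))
    linarith
  have hint : Integrable (fun ω => Real.exp (c₂ / 4 * (X ω - m) ^ 2)) P := by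
    refine (hi.mul_const (Real.exp c₁)).mono' (by fun_prop) (ae_of_all _ fun ω => ?_)
    rw [Real.norm_of_nonneg (Real.exp_pos _).le]
    exact hpt ω
  refine ⟨hint, (integral_mono hint (hi.mul_const _) hpt).trans ?_⟩
  rw [integral_mul_const]
  gcongr

/-- A centered variable with an exponential moment has a locally sub-Gaussian moment generating
function. -/
lemma mgf_le_of_integral_exp_abs_le {Y : Ω → ℝ} (hY : Measurable Y) {θ B : ℝ} (hθ : 0 < θ)
    (hi : Integrable (fun ω => Real.exp (θ * |Y ω|)) P) (hB : ∫ ω, Real.exp (θ * |Y ω|) ∂P ≤ B)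
    (hmean : ∫ ω, Y ω ∂P = 0) {s : ℝ} (hs : |s| ≤ θ / 2) :
    Integrable (fun ω => Real.exp (s * Y ω)) P ∧
      mgf Y P s ≤ Real.exp (8 * B / θ ^ 2 * s ^ 2) := by
  have hYi : Integrable Y P := by
    refine (hi.const_mul θ⁻¹).mono' hY.aestronglyMeasurable (ae_of_all _ fun ω => ?_)
    rw [Real.norm_eq_abs, le_inv_mul_iff₀ hθ]
    linarith [Real.add_one_le_exp (θ * |Y ω|)]
  have hle : ∀ ω, |s * Y ω| ≤ θ / 2 * |Y ω| := fun ω => by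
    rw [abs_mul]; gcongr
  have hint : Integrable (fun ω => Real.exp (s * Y ω)) P := by
    refine hi.mono' (by fun_prop) (ae_of_all _ fun ω => ?_)
    rw [Real.norm_of_nonneg (Real.exp_pos _).le]
    refine Real.exp_le_exp.2 ((le_abs_self _).trans ((hle ω).trans ?_))
    have := mul_nonneg hθ.le (abs_nonneg (Y ω))
    linarith
  refine ⟨hint, ?_⟩
  have hpt : ∀ ω, Real.exp (s * Y ω) ≤ 1 + s * Y ω + 8 / θ ^ 2 * s ^ 2 * Real.exp (θ * |Y ω|) := by
    intro ω
    refine (exp_le_one_add_add_sq_mul_exp_abs _).trans ?_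
    -- Half of the exponent θ pays for the square, the other half for exp |sY|; hence the
    -- restriction |s| ≤ θ/2.
    have h1 : Y ω ^ 2 ≤ 8 / θ ^ 2 * Real.exp (θ / 2 * |Y ω|) := by
      have h := Real.quadratic_le_exp_of_nonneg (by positivity : 0 ≤ θ / 2 * |Y ω|)
      have h3 : (θ / 2 * |Y ω|) ^ 2 = θ ^ 2 / 4 * Y ω ^ 2 := by rw [mul_pow, sq_abs]; ring
      rw [h3] at h
      have h4 : 0 ≤ θ / 2 * |Y ω| := by positivity
      rw [div_mul_eq_mul_div, le_div_iff₀ (by positivity)]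
      linarith
    have h2 : Real.exp |s * Y ω| ≤ Real.exp (θ / 2 * |Y ω|) := Real.exp_le_exp.2 (hle ω)
    have h3 : Real.exp (θ * |Y ω|) = Real.exp (θ / 2 * |Y ω|) * Real.exp (θ / 2 * |Y ω|) := by
      rw [← Real.exp_add]; ring_nf
    rw [h3, mul_pow]
    have : s ^ 2 * Y ω ^ 2 * Real.exp |s * Y ω| ≤
        s ^ 2 * (8 / θ ^ 2 * Real.exp (θ / 2 * |Y ω|)) * Real.exp (θ / 2 * |Y ω|) := by
      gcongr
    linarith
  have hlin : Integrable (fun ω => 1 + s * Y ω) P := (integrable_const 1).add (hYi.const_mul s)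
  have hmono := integral_mono hint (hlin.add (hi.const_mul (8 / θ ^ 2 * s ^ 2))) hpt
  simp only [Pi.add_apply] at hmono
  rw [integral_add hlin (hi.const_mul _),
    integral_add (integrable_const 1) (hYi.const_mul s), integral_const_mul, integral_const_mul,
    hmean] at hmono
  simp only [integral_const, probReal_univ, one_smul, mul_zero, add_zero] at hmono
  refine hmono.trans (le_trans ?_ (Real.add_one_le_exp _))
  have : 8 / θ ^ 2 * s ^ 2 * ∫ ω, Real.exp (θ * |Y ω|) ∂P ≤ 8 / θ ^ 2 * s ^ 2 * B := by gcongr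
  calc _ ≤ 1 + 8 / θ ^ 2 * s ^ 2 * B := by linarith
    _ = _ := by ring

/-- Two-sided Chernoff bound; s stays free because the two regimes of Bernstein's inequality choose
it differently. -/
lemma measureReal_abs_sum_ge_le {ι : Type*} {Y : ι → Ω → ℝ} (hind : iIndepFun Y P)
    (hY : ∀ i, Measurable (Y i)) {θ B : ℝ} (hθ : 0 < θ)
    (hi : ∀ i, Integrable (fun ω => Real.exp (θ * |Y i ω|)) P)
    (hB : ∀ i, ∫ ω, Real.exp (θ * |Y i ω|) ∂P ≤ B) (hmean : ∀ i, ∫ ω, Y i ω ∂P = 0)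
    (I : Finset ι) {s : ℝ} (hs0 : 0 ≤ s) (hs : s ≤ θ / 2) (v : ℝ) :
    P.real {ω | v ≤ |∑ i ∈ I, Y i ω|} ≤
      2 * Real.exp (-s * v + 8 * B / θ ^ 2 * s ^ 2 * I.card) := by
  have hprod : ∀ t : ℝ, |t| = s → mgf (∑ i ∈ I, Y i) P t ≤
      Real.exp (8 * B / θ ^ 2 * s ^ 2 * I.card) := by
    intro t ht
    rw [hind.mgf_sum hY]
    calc ∏ i ∈ I, mgf (Y i) P t ≤ ∏ _i ∈ I, Real.exp (8 * B / θ ^ 2 * t ^ 2) :=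
          Finset.prod_le_prod (fun i _ => mgf_nonneg) fun i _ =>
            (mgf_le_of_integral_exp_abs_le (hY i) hθ (hi i) (hB i) (hmean i) (by rw [ht]; exact hs)).2
      _ = _ := by
          rw [Finset.prod_const, ← Real.exp_nat_mul, ← sq_abs t, ht]; ring_nf
  have hint : ∀ t : ℝ, |t| = s → Integrable (fun ω => Real.exp (t * (∑ i ∈ I, Y i) ω)) P :=
    fun t ht => hind.integrable_exp_mul_sum hY fun i _ =>
      (mgf_le_of_integral_exp_abs_le (hY i) hθ (hi i) (hB i) (hmean i) (by rw [ht]; exact hs)).1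
  have h1 := measure_ge_le_exp_mul_mgf v hs0 (hint s (abs_of_nonneg hs0))
  have h2 := measure_le_le_exp_mul_mgf (-v) (neg_nonpos.2 hs0)
    (hint (-s) (by rw [abs_neg, abs_of_nonneg hs0]))
  have h3 := hprod s (abs_of_nonneg hs0)
  have h4 := hprod (-s) (by rw [abs_neg, abs_of_nonneg hs0])
  have hsub : {ω | v ≤ |∑ i ∈ I, Y i ω|} ⊆
      {ω | v ≤ (∑ i ∈ I, Y i) ω} ∪ {ω | (∑ i ∈ I, Y i) ω ≤ -v} := by
    intro ω hω
    simp only [Set.mem_ofPred_eq, Set.mem_union, Finset.sum_apply] at hω ⊢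
    rcases le_abs.1 hω with h | h
    · exact Or.inl h
    · exact Or.inr (by linarith)
  refine (measureReal_mono hsub).trans ((measureReal_union_le _ _).trans ?_)
  have h5 : Real.exp (-s * v) * mgf (∑ i ∈ I, Y i) P s ≤
      Real.exp (-s * v + 8 * B / θ ^ 2 * s ^ 2 * I.card) := by
    rw [Real.exp_add]; gcongr
  have h6 : Real.exp (-(-s) * -v) * mgf (∑ i ∈ I, Y i) P (-s) ≤
      Real.exp (-s * v + 8 * B / θ ^ 2 * s ^ 2 * I.card) := by
    rw [Real.exp_add, show -(-s) * -v = -s * v by ring]; gcongr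
  linarith

/-- Bernstein's inequality at noise level `r`. -/
lemma measureReal_lt_abs_sum_le {ι : Type*} {Y : ι → Ω → ℝ} (hind : iIndepFun Y P)
    (hY : ∀ i, Measurable (Y i)) {θ B κ K r : ℝ} (hθ : 0 < θ) (hB0 : 0 ≤ B)
    (hi : ∀ i, Integrable (fun ω => Real.exp (θ * |Y i ω|)) P)
    (hB : ∀ i, ∫ ω, Real.exp (θ * |Y i ω|) ∂P ≤ B) (hmean : ∀ i, ∫ ω, Y i ω ∂P = 0)
    (hr : 0 ≤ r) (hK0 : 0 ≤ K) (hK : 8 * B / θ ^ 2 * (θ / 2) + κ / (θ / 2) ≤ K) (I : Finset ι) :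
    P.real {ω | K * (r * √(I.card : ℝ) + r ^ 2) < |∑ i ∈ I, Y i ω|} ≤
      2 * Real.exp (-κ * r ^ 2) := by
  have hsub : {ω | K * (r * √(I.card : ℝ) + r ^ 2) < |∑ i ∈ I, Y i ω|} ⊆
      {ω | K * (r * √(I.card : ℝ) + r ^ 2) ≤ |∑ i ∈ I, Y i ω|} := by
    intro ω hω
    simp only [Set.mem_ofPred_eq] at hω ⊢
    exact hω.le
  refine (measureReal_mono hsub).trans ?_
  obtain ⟨s₁, hs₁⟩ : ∃ s₁, s₁ = θ / 2 := ⟨_, rfl⟩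
  have hs₁0 : 0 < s₁ := by rw [hs₁]; positivity
  rw [← hs₁] at hK
  set Γ := 8 * B / θ ^ 2
  have hΓ : 0 ≤ Γ := by positivity
  have hKs : Γ * s₁ ^ 2 + κ ≤ K * s₁ := by
    have := mul_le_mul_of_nonneg_right hK hs₁0.le
    rw [add_mul, div_mul_cancel₀ _ hs₁0.ne'] at this
    linarith
  have hKr : (Γ * s₁ ^ 2 + κ) * r ^ 2 ≤ K * s₁ * r ^ 2 := by gcongr
  set N : ℝ := (I.card : ℝ)
  have hN : 0 ≤ N := Nat.cast_nonneg _
  have hNN : √N ^ 2 = N := Real.sq_sqrt hN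
  have hsN : 0 ≤ √N := Real.sqrt_nonneg N
  -- Gaussian regime r ≤ √N: take s = (θ/2)r/√N, the case N = 0 being trivial since then r = 0.
  -- Otherwise the largest admissible s = θ/2 is used.
  rcases le_or_gt r √N with hc | hc
  · rcases hsN.eq_or_lt with h0 | hpos
    · have hr0 : r = 0 := le_antisymm (h0 ▸ hc) hr
      refine (measureReal_le_one (μ := P)).trans ?_
      rw [hr0]; simp
    · have hss : s₁ * (r / √N) ≤ θ / 2 := by
        rw [← hs₁]
        exact mul_le_of_le_one_right hs₁0.le ((div_le_one hpos).2 hc)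
      refine (measureReal_abs_sum_ge_le hind hY hθ hi hB hmean I (s := s₁ * (r / √N))
        (by positivity) hss _).trans ?_
      gcongr
      have e1 : s₁ * (r / √N) * (K * (r * √N + r ^ 2)) = K * s₁ * r ^ 2
          + s₁ * (r / √N) * K * r ^ 2 := by
        field_simp
      have e2 : Γ * (s₁ * (r / √N)) ^ 2 * N = Γ * s₁ ^ 2 * r ^ 2 := by
        nth_rw 2 [← hNN]
        field_simp
      have e3 : 0 ≤ s₁ * (r / √N) * K * r ^ 2 := by positivity
      change -(s₁ * (r / √N)) * (K * (r * √N + r ^ 2)) + Γ * (s₁ * (r / √N)) ^ 2 * N ≤ -κ * r ^ 2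
      rw [e2]
      linarith
  · refine (measureReal_abs_sum_ge_le hind hY hθ hi hB hmean I hs₁0.le hs₁.le _).trans ?_
    gcongr
    change -s₁ * (K * (r * √N + r ^ 2)) + Γ * s₁ ^ 2 * N ≤ -κ * r ^ 2
    have h1 : N ≤ r ^ 2 := by rw [← hNN]; gcongr
    have h2 : Γ * s₁ ^ 2 * N ≤ Γ * s₁ ^ 2 * r ^ 2 := by gcongr
    have h3 : 0 ≤ s₁ * (K * (r * √N)) := by positivity
    linarith

end

end CovChangePoint

namespace CovChangePoint

/-! ### The good event has large probability -/

lemma abs_entry_le_spectralNorm {p : ℕ} (S : Matrix (Fin p) (Fin p) ℝ) (a b : Fin p) :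
    |S a b| ≤ spectralNorm S := by
  have h1 := Matrix.inner_toEuclideanCLM S (EuclideanSpace.single a 1) (EuclideanSpace.single b 1)
  have h2 : ‖Matrix.toEuclideanCLM (n := Fin p) (𝕜 := ℝ) S (EuclideanSpace.single b 1)‖ ≤
      spectralNorm S := by
    have := (Matrix.toEuclideanCLM (n := Fin p) (𝕜 := ℝ) S).le_opNorm (EuclideanSpace.single b 1)
    simpa [spectralNorm] using this
  have h3 := abs_real_inner_le_norm (EuclideanSpace.single a (1 : ℝ))
    (Matrix.toEuclideanCLM (n := Fin p) (𝕜 := ℝ) S (EuclideanSpace.single b 1))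
  rw [h1] at h3
  simp at h3
  exact h3.trans h2

lemma exp_half_add_half_le (x y : ℝ) :
    Real.exp (x / 2 + y / 2) ≤ (Real.exp x + Real.exp y) / 2 := by
  have hx : Real.exp x = Real.exp (x / 2) ^ 2 := by rw [sq, ← Real.exp_add]; ring_nf
  have hy : Real.exp y = Real.exp (y / 2) ^ 2 := by rw [sq, ← Real.exp_add]; ring_nf
  rw [Real.exp_add, hx, hy]
  linarith [sq_nonneg (Real.exp (x / 2) - Real.exp (y / 2))]

section

variable {Ω : Type u} [MeasurableSpace Ω] {P : Measure Ω}

lemma integral_exp_le_of_le {f g : Ω → ℝ} (hf : Measurable f) (hg : Integrable g P) {B : ℝ}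
    (hB : ∫ ω, g ω ∂P ≤ B) (hfg : ∀ ω, Real.exp (f ω) ≤ g ω) :
    Integrable (fun ω => Real.exp (f ω)) P ∧ ∫ ω, Real.exp (f ω) ∂P ≤ B := by
  have hint : Integrable (fun ω => Real.exp (f ω)) P := by
    refine hg.mono' (by fun_prop) (ae_of_all _ fun ω => ?_)
    rw [Real.norm_of_nonneg (Real.exp_pos _).le]
    exact hfg ω
  exact ⟨hint, (integral_mono hint hg hfg).trans hB⟩

/-- From |z| ≤ z² + 1. The constant is padded by M to agree with that for products, so one K serves
both. -/
lemma integral_exp_abs_le {Z : Ω → ℝ} (hZ : Measurable Z) {θ M B : ℝ} (hθ : 0 < θ) (hM : 0 ≤ M)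
    (hi : Integrable (fun ω => Real.exp (θ * Z ω ^ 2)) P)
    (hB : ∫ ω, Real.exp (θ * Z ω ^ 2) ∂P ≤ B) :
    Integrable (fun ω => Real.exp (θ * |Z ω|)) P ∧
      ∫ ω, Real.exp (θ * |Z ω|) ∂P ≤ Real.exp (θ * (M + 1)) * B := by
  refine integral_exp_le_of_le (by fun_prop) (hi.const_mul (Real.exp (θ * (M + 1)))) ?_ fun ω => ?_
  · rw [integral_const_mul]; gcongr
  · rw [← Real.exp_add, ← mul_add]
    gcongr
    have h1 := sq_nonneg (|Z ω| - 1)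
    have h2 := sq_abs (Z ω)
    have h3 := abs_nonneg (Z ω)
    nlinarith

lemma integral_exp_abs_mul_sub_le {Z W : Ω → ℝ} (hZ : Measurable Z) (hW : Measurable W)
    {θ M B σ : ℝ} (hθ : 0 < θ) (hσ : |σ| ≤ M)
    (hi : Integrable (fun ω => Real.exp (θ * Z ω ^ 2)) P)
    (hB : ∫ ω, Real.exp (θ * Z ω ^ 2) ∂P ≤ B)
    (hi' : Integrable (fun ω => Real.exp (θ * W ω ^ 2)) P)
    (hB' : ∫ ω, Real.exp (θ * W ω ^ 2) ∂P ≤ B) :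
    Integrable (fun ω => Real.exp (θ * |Z ω * W ω - σ|)) P ∧
      ∫ ω, Real.exp (θ * |Z ω * W ω - σ|) ∂P ≤ Real.exp (θ * (M + 1)) * B := by
  refine integral_exp_le_of_le (by fun_prop)
    (((hi.add hi').div_const 2).const_mul (Real.exp (θ * (M + 1)))) ?_ fun ω => ?_
  · simp only [Pi.add_apply]
    rw [integral_const_mul, integral_div, integral_add hi hi']
    gcongr
    linarith
  · have h1 : |Z ω * W ω - σ| ≤ Z ω ^ 2 / 2 + W ω ^ 2 / 2 + M := by
      rw [abs_le] at hσ ⊢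
      constructor
      · linarith [sq_nonneg (Z ω + W ω)]
      · linarith [sq_nonneg (Z ω - W ω)]
    calc Real.exp (θ * |Z ω * W ω - σ|)
        ≤ Real.exp (θ * (M + 1) + (θ * Z ω ^ 2 / 2 + θ * W ω ^ 2 / 2)) := by
          refine Real.exp_le_exp.2 ((mul_le_mul_of_nonneg_left h1 hθ.le).trans ?_)
          linarith
      _ ≤ _ := by
          rw [Real.exp_add]
          gcongr
          exact exp_half_add_half_le _ _

variable [IsProbabilityMeasure P] {n p : ℕ} {X : Fin n → Ω → Fin p → ℝ} {k₀ : ℕ} {S₁ S₂ : Matrix (Fin p) (Fin p) ℝ}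

/-- A union bound for the complement of the good event. -/
lemma measureReal_not_goodSample_le (hn : 1 ≤ n) {Z : Fin n → Ω → Fin p → ℝ} {K r e B : ℝ}
    (he : 0 ≤ e) (hB : 0 ≤ B)
    (hlin : ∀ a (I : Finset (Fin n)),
      P.real {ω | K * (r * √(I.card : ℝ) + r ^ 2) < |∑ i ∈ I, Z i ω a|} ≤ 2 * e)
    (hmul : ∀ a b (I : Finset (Fin n)), P.real {ω | K * (r * √(I.card : ℝ) + r ^ 2) <
      |∑ i ∈ I, (Z i ω a * Z i ω b - covAt S₁ S₂ k₀ i a b)|} ≤ 2 * e)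
    (hmax : ∀ i a, P.real {ω | K * r < |Z i ω a|} ≤ B * e) :
    P.real {ω | ¬ GoodSample (fun i => Z i ω) S₁ S₂ k₀ K r} ≤ (16 + B) * (p : ℝ) ^ 2 * n * e := by
  set E₁ : Fin p × Fin (n + 1) → Set Ω := fun q =>
    {ω | K * (r * √((firstIdx n q.2).card : ℝ) + r ^ 2) < |∑ i ∈ firstIdx n q.2, Z i ω q.1|}
  set E₂ : Fin p × Fin (n + 1) → Set Ω := fun q =>
    {ω | K * (r * √((lastIdx n q.2).card : ℝ) + r ^ 2) < |∑ i ∈ lastIdx n q.2, Z i ω q.1|}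
  set E₃ : Fin p × Fin p × Fin (n + 1) → Set Ω := fun q =>
    {ω | K * (r * √((firstIdx n q.2.2).card : ℝ) + r ^ 2) <
      |∑ i ∈ firstIdx n q.2.2, (Z i ω q.1 * Z i ω q.2.1 - covAt S₁ S₂ k₀ i q.1 q.2.1)|}
  set E₄ : Fin p × Fin p × Fin (n + 1) → Set Ω := fun q =>
    {ω | K * (r * √((lastIdx n q.2.2).card : ℝ) + r ^ 2) <
      |∑ i ∈ lastIdx n q.2.2, (Z i ω q.1 * Z i ω q.2.1 - covAt S₁ S₂ k₀ i q.1 q.2.1)|}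
  set E₅ : Fin n × Fin p → Set Ω := fun q => {ω | K * r < |Z q.1 ω q.2|}
  have hsub : {ω | ¬ GoodSample (fun i => Z i ω) S₁ S₂ k₀ K r} ⊆
      (⋃ q, E₁ q) ∪ ((⋃ q, E₂ q) ∪ ((⋃ q, E₃ q) ∪ ((⋃ q, E₄ q) ∪ ⋃ q, E₅ q))) := by
    intro ω hω
    by_contra hcon
    simp only [Set.mem_union, Set.mem_iUnion, not_or, not_exists] at hcon
    obtain ⟨h1, h2, h3, h4, h5⟩ := hcon
    simp only [E₁, E₂, E₃, E₄, E₅, Set.mem_ofPred_eq, not_lt] at h1 h2 h3 h4 h5 hω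
    refine hω ⟨fun a k hk => ?_, fun a k hk => ?_, fun a b k hk => ?_, fun a b k hk => ?_,
      fun i a => h5 (i, a)⟩
    · have := h1 (a, ⟨k, by omega⟩)
      rwa [card_firstIdx hk] at this
    · have := h2 (a, ⟨k, by omega⟩)
      rwa [card_lastIdx hk, Nat.cast_sub hk] at this
    · have := h3 (a, b, ⟨k, by omega⟩)
      rwa [card_firstIdx hk] at this
    · have := h4 (a, b, ⟨k, by omega⟩)
      rwa [card_lastIdx hk, Nat.cast_sub hk] at this
  have hunion : ∀ {ι : Type} [Fintype ι] (E : ι → Set Ω) (c : ℝ), (∀ q, P.real (E q) ≤ c) →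
      P.real (⋃ q, E q) ≤ Fintype.card ι * c := by
    intro ι _ E c hE
    refine (measureReal_iUnion_fintype_le E).trans ?_
    have := Finset.sum_le_card_nsmul Finset.univ (fun q => P.real (E q)) c fun q _ => hE q
    simpa using this
  have u1 := hunion E₁ (2 * e) fun q => hlin _ _
  have u2 := hunion E₂ (2 * e) fun q => hlin _ _
  have u3 := hunion E₃ (2 * e) fun q => hmul _ _ _
  have u4 := hunion E₄ (2 * e) fun q => hmul _ _ _
  have u5 := hunion E₅ (B * e) fun q => hmax _ _
  simp only [Fintype.card_prod, Fintype.card_fin, Nat.cast_mul, Nat.cast_add, Nat.cast_one]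
    at u1 u2 u3 u4 u5
  have hall := (measureReal_mono (μ := P) hsub).trans ((measureReal_union_le _ _).trans
    (add_le_add le_rfl ((measureReal_union_le _ _).trans (add_le_add le_rfl
      ((measureReal_union_le _ _).trans (add_le_add le_rfl (measureReal_union_le _ _)))))))
  have hn' : (1 : ℝ) ≤ n := by exact_mod_cast hn
  have hp : (p : ℝ) ≤ (p : ℝ) * p := by exact_mod_cast Nat.le_mul_self p
  have hp0 : (0 : ℝ) ≤ p := Nat.cast_nonneg p
  -- There are n + 1 ≤ 2n splits, so each of the four families of sums costs at most 4p²ne, in total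
  -- 16p²ne.
  have b1 : (p : ℝ) * (n + 1) * (2 * e) ≤ (p * p) * (2 * n) * (2 * e) := by
    gcongr; linarith
  have b3 : (p : ℝ) * (p * (n + 1)) * (2 * e) ≤ p * (p * (2 * n)) * (2 * e) := by
    gcongr; linarith
  have b5 : (n : ℝ) * p * (B * e) ≤ n * (p * p) * (B * e) := by gcongr
  linarith

lemma IsChangePointModel.measureReal_not_goodSample_le (hmod : IsChangePointModel P X k₀ S₁ S₂)
    {C₁ C₂ M : ℝ} (hC₁ : 0 < C₁) (hC₂ : 0 < C₂) (hM : 0 < M)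
    (htail : TailAndNormBound P X S₁ S₂ C₁ C₂ M) {m : Fin p → ℝ}
    (hm : ∀ i a, ∫ ω, X i ω a ∂P = m a) {κ K r θ B : ℝ} (hr : 0 ≤ r)
    (hθ : θ = C₂ / 4) (hB : B = (1 + C₁) * Real.exp C₁) (hK1 : 1 ≤ K)
    (hK : 8 * (Real.exp (θ * (M + 1)) * B) / θ ^ 2 * (θ / 2) + κ / (θ / 2) ≤ K)
    (hK' : κ / θ ≤ K) :
    P.real {ω | ¬ GoodSample (fun i a => X i ω a - m a) S₁ S₂ k₀ K r} ≤
      (16 + B) * (p : ℝ) ^ 2 * n * Real.exp (-κ * r ^ 2) := by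
  have hθ0 : 0 < θ := by rw [hθ]; positivity
  have hB0 : 0 ≤ B := by rw [hB]; positivity
  have hXm : ∀ i a, Measurable (fun ω => X i ω a) := fun i a =>
    (measurable_pi_apply a).comp (hmod.measurable i)
  have hZm : ∀ i a, Measurable (fun ω => X i ω a - m a) := fun i a => (hXm i a).sub_const _
  have hexp : ∀ i a, Integrable (fun ω => Real.exp (θ * (X i ω a - m a) ^ 2)) P ∧
      ∫ ω, Real.exp (θ * (X i ω a - m a) ^ 2) ∂P ≤ B := by
    intro i a
    rw [hθ, hB]
    exact integral_exp_sq_sub_mean_le (hXm i a) (hmod.memLp i a) hC₁ hC₂ (htail.tail i a) (hm i a)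
  have hcov : ∀ (i : Fin n) a b, |covAt S₁ S₂ k₀ i a b| ≤ M := by
    intro i a b
    unfold covAt
    split_ifs
    · exact (abs_entry_le_spectralNorm S₁ a b).trans htail.norm_before
    · exact (abs_entry_le_spectralNorm S₂ a b).trans htail.norm_after
  have hZ2 : ∀ i a, MemLp (fun ω => X i ω a - m a) 2 P := fun i a =>
    (hmod.memLp i a).sub (memLp_const (m a))
  have hlin0 : ∀ i a, ∫ ω, (X i ω a - m a) ∂P = 0 := by
    intro i a
    rw [integral_sub ((hmod.memLp i a).integrable one_le_two) (integrable_const _), hm]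
    simp
  have hmul0 : ∀ i a b, ∫ ω, ((X i ω a - m a) * (X i ω b - m b) - covAt S₁ S₂ k₀ i a b) ∂P = 0 := by
    intro i a b
    have hint : Integrable (fun ω => (X i ω a - m a) * (X i ω b - m b)) P :=
      (hZ2 i a).integrable_mul (hZ2 i b)
    rw [integral_sub hint (integrable_const _)]
    have hc : ∫ ω, (X i ω a - m a) * (X i ω b - m b) ∂P = covAt S₁ S₂ k₀ i a b := by
      have hcv : cov[fun ω => X i ω a, fun ω => X i ω b; P] = covAt S₁ S₂ k₀ i a b := by
        unfold covAt
        split_ifs with h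
        · exact hmod.cov_before i h a b
        · exact hmod.cov_after i (not_lt.1 h) a b
      rw [← hcv, covariance, hm, hm]
    rw [hc]; simp
  refine CovChangePoint.measureReal_not_goodSample_le (le_trans hmod.one_le hmod.lt.le)
    (Z := fun i ω a => X i ω a - m a) (Real.exp_pos _).le hB0 (fun a I => ?_) (fun a b I => ?_)
    fun i a => ?_
  · have hind : iIndepFun (fun i ω => X i ω a - m a) P :=
      hmod.indep.comp (fun _ x => x a - m a) fun _ => by fun_prop
    have he := fun i => integral_exp_abs_le (hZm i a) hθ0 hM.le (hexp i a).1 (hexp i a).2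
    exact measureReal_lt_abs_sum_le hind (fun i => hZm i a) hθ0 (by positivity)
      (fun i => (he i).1) (fun i => (he i).2) (fun i => hlin0 i a) hr (by linarith) hK I
  · have hind : iIndepFun
        (fun i ω => (X i ω a - m a) * (X i ω b - m b) - covAt S₁ S₂ k₀ i a b) P :=
      hmod.indep.comp (fun i x => (x a - m a) * (x b - m b) - covAt S₁ S₂ k₀ i a b)
        fun _ => by fun_prop
    have he := fun i => integral_exp_abs_mul_sub_le (hZm i a) (hZm i b) hθ0 (hcov i a b)
      (hexp i a).1 (hexp i a).2 (hexp i b).1 (hexp i b).2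
    exact measureReal_lt_abs_sum_le hind (fun i => ((hZm i a).mul (hZm i b)).sub_const _) hθ0
      (by positivity) (fun i => (he i).1) (fun i => (he i).2) (fun i => hmul0 i a b) hr
      (by linarith) hK I
  · have h1 := measure_ge_le_exp_mul_mgf (μ := P) (X := fun ω => (X i ω a - m a) ^ 2)
      ((K * r) ^ 2) hθ0.le (hexp i a).1
    have hsub : {ω | K * r < |X i ω a - m a|} ⊆ {ω | (K * r) ^ 2 ≤ (X i ω a - m a) ^ 2} := by
      intro ω hω
      simp only [Set.mem_ofPred_eq] at hω ⊢
      rw [← sq_abs (X i ω a - m a)]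
      exact pow_le_pow_left₀ (by positivity) hω.le 2
    refine (measureReal_mono hsub).trans (h1.trans ?_)
    rw [mul_comm B]
    refine mul_le_mul (Real.exp_le_exp.2 ?_) (hexp i a).2 mgf_nonneg (Real.exp_pos _).le
    have h2 : κ ≤ θ * K ^ 2 := by
      rw [div_le_iff₀ hθ0] at hK'
      have : K * θ ≤ K ^ 2 * θ := by gcongr; exact le_self_pow₀ hK1 (by norm_num)
      linarith
    have h3 := mul_le_mul_of_nonneg_right h2 (sq_nonneg r)
    linarith

end

end CovChangePoint

namespace CovChangePoint

/-! ### The deviation probability of the estimator -/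

section

variable {Ω : Type u} [MeasurableSpace Ω] {P : Measure Ω}
  {n p : ℕ} {X : Fin n → Ω → Fin p → ℝ} {k₀ : ℕ} {S₁ S₂ : Matrix (Fin p) (Fin p) ℝ}

/-- Both matrices are symmetric, being covariances of observations that exist because 1 ≤ k₀ < n.
The order a ≤ b is what `kept` demands. -/
lemma IsChangePointModel.exists_le_ne (hmod : IsChangePointModel P X k₀ S₁ S₂) :
    ∃ a b, a ≤ b ∧ S₁ a b ≠ S₂ a b := by
  have h1 : ∀ a b, S₁ a b = S₁ b a := by
    intro a b
    have hlt : (⟨0, by have := hmod.one_le; have := hmod.lt; omega⟩ : Fin n).val < k₀ := hmod.one_le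
    rw [← hmod.cov_before _ hlt a b, ← hmod.cov_before _ hlt b a, covariance_comm]
  have h2 : ∀ a b, S₂ a b = S₂ b a := by
    intro a b
    have hle : k₀ ≤ (⟨k₀, hmod.lt⟩ : Fin n).val := le_rfl
    rw [← hmod.cov_after _ hle a b, ← hmod.cov_after _ hle b a, covariance_comm]
  obtain ⟨a, b, hab⟩ : ∃ a b, S₁ a b ≠ S₂ a b := by
    by_contra hcon
    push Not at hcon
    exact hmod.ne (Matrix.ext hcon)
  rcases le_total a b with h | h
  · exact ⟨a, b, h, hab⟩
  · exact ⟨b, a, h, by rwa [h1 b a, h2 b a]⟩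

lemma MinimalSignal.le_abs_sub {τ C : ℝ} (hsig : MinimalSignal n k₀ τ C S₁ S₂) {a b : Fin p}
    (hne : S₁ a b ≠ S₂ a b) :
    C * √(τ / n) * max ((n : ℝ) ^ 2 / ((n : ℝ) - k₀) ^ 2) ((n : ℝ) ^ 2 / (k₀ : ℝ) ^ 2) ≤
      |S₁ a b - S₂ a b| := by
  obtain ⟨l, hl, hle⟩ := hsig
  exact hle.trans (hl a b hne).le

lemma MinimalSignal.mul_le {r C : ℝ} (hC : 0 ≤ C) (hk₀ : 1 ≤ k₀) (hk₀n : k₀ < n)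
    (hsig : MinimalSignal n k₀ (r ^ 4) C S₁ S₂) {a b : Fin p} (hne : S₁ a b ≠ S₂ a b) :
    C * r ^ 2 * n ^ 2 ≤ |S₁ a b - S₂ a b| * √(n : ℝ) * (k₀ : ℝ) ^ 2 ∧
      C * r ^ 2 * n ^ 2 ≤ |S₁ a b - S₂ a b| * √(n : ℝ) * ((n : ℝ) - k₀) ^ 2 := by
  have h := hsig.le_abs_sub hne
  have hk : (0 : ℝ) < k₀ := by exact_mod_cast hk₀
  have hkn : (0 : ℝ) < (n : ℝ) - k₀ := by
    have : (k₀ : ℝ) < n := by exact_mod_cast hk₀n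
    linarith
  have hN : 0 < √(n : ℝ) := Real.sqrt_pos.2 (by linarith)
  have hs : √(r ^ 4 / n) = r ^ 2 / √(n : ℝ) := by
    rw [Real.sqrt_div (by positivity), show r ^ 4 = (r ^ 2) ^ 2 by ring, Real.sqrt_sq (by positivity)]
  rw [hs] at h
  have hc : 0 ≤ C * (r ^ 2 / √(n : ℝ)) := by positivity
  have key : ∀ d : ℝ, 0 < d → C * (r ^ 2 / √(n : ℝ)) * ((n : ℝ) ^ 2 / d ^ 2) ≤ |S₁ a b - S₂ a b| →
      C * r ^ 2 * n ^ 2 ≤ |S₁ a b - S₂ a b| * √(n : ℝ) * d ^ 2 := by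
    intro d hd hle
    have h2 := mul_le_mul_of_nonneg_right hle (by positivity : 0 ≤ √(n : ℝ) * d ^ 2)
    have h3 : C * (r ^ 2 / √(n : ℝ)) * ((n : ℝ) ^ 2 / d ^ 2) * (√(n : ℝ) * d ^ 2)
        = C * r ^ 2 * n ^ 2 := by field_simp
    rw [h3] at h2
    linarith
  exact ⟨key _ hk ((mul_le_mul_of_nonneg_left (le_max_right _ _) hc).trans h),
    key _ hkn ((mul_le_mul_of_nonneg_left (le_max_left _ _) hc).trans h)⟩

/-- Entries differ by at most 2M, so a signal constant C ≥ 2M forces √(τ/n) ≤ 1. This supplies the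
condition r⁴ ≤ n. -/
lemma TailAndNormBound.threshold_le (hmod : IsChangePointModel P X k₀ S₁ S₂)
    {C₁ C₂ M : ℝ} (htail : TailAndNormBound P X S₁ S₂ C₁ C₂ M) {τ C : ℝ} (hC : 0 < C)
    (hCM : 2 * M ≤ C) (hsig : MinimalSignal n k₀ τ C S₁ S₂) : τ ≤ n := by
  obtain ⟨a, b, _, hne⟩ := hmod.exists_le_ne
  have h := hsig.le_abs_sub hne
  have hk : (0 : ℝ) < k₀ := by exact_mod_cast hmod.one_le
  have hkn : (k₀ : ℝ) < n := by exact_mod_cast hmod.lt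
  have hmax : 1 ≤ max ((n : ℝ) ^ 2 / ((n : ℝ) - k₀) ^ 2) ((n : ℝ) ^ 2 / (k₀ : ℝ) ^ 2) := by
    refine le_max_of_le_right ?_
    rw [one_le_div (by positivity)]
    gcongr
  have hbound : |S₁ a b - S₂ a b| ≤ 2 * M := by
    have h1 := (abs_entry_le_spectralNorm S₁ a b).trans htail.norm_before
    have h2 := (abs_entry_le_spectralNorm S₂ a b).trans htail.norm_after
    linarith [abs_sub (S₁ a b) (S₂ a b)]
  have h3 : C * √(τ / n) ≤ C * 1 := by
    have : C * √(τ / n) * 1 ≤ C * √(τ / n) *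
        max ((n : ℝ) ^ 2 / ((n : ℝ) - k₀) ^ 2) ((n : ℝ) ^ 2 / (k₀ : ℝ) ^ 2) := by gcongr
    linarith
  have h4 : √(τ / n) ≤ 1 := le_of_mul_le_mul_left h3 hC
  have h5 := (Real.sqrt_le_iff.1 h4).2
  rwa [one_pow, div_le_one (by linarith)] at h5

end

/-- For every rate `κ`, the deviation probability is at most a multiple of `p² n exp (-κ √τ)` as soon
as the threshold is large enough. -/
theorem exists_threshold_measureReal_le {C₁ C₂ M κ ε : ℝ} (hC₁ : 0 < C₁) (hC₂ : 0 < C₂) (hM : 0 < M)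
    (hκ : 0 < κ) (hε : 0 < ε) :
    ∃ τ₀ A : ℝ, 0 < τ₀ ∧ 0 < A ∧
      ∀ (Ω : Type u) [MeasurableSpace Ω] (P : Measure Ω) [IsProbabilityMeasure P]
        (n p k₀ : ℕ) (X : Fin n → Ω → Fin p → ℝ) (S₁ S₂ : Matrix (Fin p) (Fin p) ℝ)
        (τ C : ℝ) (khat : Ω → ℕ),
        IsChangePointModel P X k₀ S₁ S₂ → TailAndNormBound P X S₁ S₂ C₁ C₂ M →
        τ₀ ≤ τ → 10 + 2 * M ≤ C → MinimalSignal n k₀ τ C S₁ S₂ →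
        (∀ ω, IsArgmaxU (fun i => X i ω) τ (khat ω)) →
        P.real {ω | ε ≤ |(khat ω : ℝ) / (k₀ : ℝ) - 1|} ≤
          A * (p : ℝ) ^ 2 * n * Real.exp (-κ * √τ) := by
  obtain ⟨θ, hθ⟩ : ∃ θ, θ = C₂ / 4 := ⟨_, rfl⟩
  obtain ⟨B, hB⟩ : ∃ B, B = (1 + C₁) * Real.exp C₁ := ⟨_, rfl⟩
  have hθ0 : 0 < θ := by rw [hθ]; positivity
  have hB0 : 0 < B := by rw [hB]; positivity
  obtain ⟨K₁, hK₁⟩ : ∃ K₁, K₁ = 8 * (Real.exp (θ * (M + 1)) * B) / θ ^ 2 * (θ / 2) + κ / (θ / 2) :=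
    ⟨_, rfl⟩
  have hK₁0 : 0 < K₁ := by rw [hK₁]; positivity
  have hκθ : 0 < κ / θ := by positivity
  obtain ⟨K, hK⟩ : ∃ K, K = 1 + K₁ + κ / θ := ⟨_, rfl⟩
  have hK1 : 1 ≤ K := by linarith
  obtain ⟨L, hL⟩ : ∃ L, L = 9 * K ^ 2 * (M + 18 * K ^ 2) + 81 * K ^ 4 := ⟨_, rfl⟩
  have hL0 : 0 < L := by rw [hL]; positivity
  -- The rate κ fixes K, and K fixes L. The summands give n ≥ r⁴ ≥ 16, the thresholding condition,
  -- and the localization condition at ε.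
  obtain ⟨r₀, hr₀⟩ : ∃ r₀, r₀ = 2 + 640 * L ^ 2 + 8 * L / ε := ⟨_, rfl⟩
  have hLε : 0 < 8 * L / ε := by positivity
  have hL2 : 0 < 640 * L ^ 2 := by positivity
  have hr₀0 : 0 < r₀ := by linarith
  refine ⟨r₀ ^ 4, 16 + B, by positivity, by positivity, ?_⟩
  intro Ω _ P _ n p k₀ X S₁ S₂ τ C khat hmod htail hτ hC hsig hkhat
  have hτ0 : 0 ≤ τ := le_trans (by positivity) hτ
  obtain ⟨r, hr⟩ : ∃ r, r = √(√τ) := ⟨_, rfl⟩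
  have hr0 : 0 ≤ r := by rw [hr]; positivity
  have hr2 : r ^ 2 = √τ := by rw [hr, Real.sq_sqrt (Real.sqrt_nonneg _)]
  have hr4 : r ^ 4 = τ := by
    rw [show r ^ 4 = (r ^ 2) ^ 2 by ring, hr2, Real.sq_sqrt hτ0]
  have hrr₀ : r₀ ≤ r := by
    rw [← hr4] at hτ
    exact (pow_le_pow_iff_left₀ hr₀0.le hr0 (by norm_num)).1 hτ
  have hrn : r ^ 4 ≤ n := by
    rw [hr4]
    exact htail.threshold_le hmod (by linarith) (by linarith) hsig
  have hn : 8 ≤ n := by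
    have h16 : (2 : ℝ) ^ 4 ≤ r ^ 4 := pow_le_pow_left₀ (by norm_num) (by linarith) 4
    have : (8 : ℝ) ≤ n := by linarith
    exact_mod_cast this
  obtain ⟨m, hm⟩ := hmod.mean
  rw [← hr2]
  refine le_trans (measureReal_mono ?_) (hmod.measureReal_not_goodSample_le hC₁ hC₂ hM htail hm
    (κ := κ) (K := K) hr0 hθ hB hK1 (by linarith) (by linarith))
  intro ω hω
  simp only [Set.mem_ofPred_eq] at hω ⊢
  intro hgood
  refine absurd hω (not_le.2 ?_)
  rw [← hr4] at hsig
  have hmul := fun a b (hne : S₁ a b ≠ S₂ a b) =>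
    hsig.mul_le (by linarith) hmod.one_le hmod.lt hne
  refine hgood.dist_lt hK1 (by linarith) hrn hn hmod.one_le hmod.lt hM.le
    (fun a => ?_) (fun a => ?_) hL (by linarith) hε ?_ (by linarith : 10 ≤ C) hmod.exists_le_ne
    (fun a b h => (hmul a b h).1) (fun a b h => (hmul a b h).2) (m := m) ?_
  · exact (le_abs_self _).trans ((abs_entry_le_spectralNorm S₁ a a).trans htail.norm_before)
  · exact (le_abs_self _).trans ((abs_entry_le_spectralNorm S₂ a a).trans htail.norm_after)
  · have : 8 * L / ε ≤ r := by linarith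
    rw [div_le_iff₀ hε] at this
    linarith
  · have := hkhat ω
    simpa [hr4] using this

lemma IsChangePointModel.one_le_dim {Ω : Type u} [MeasurableSpace Ω] {P : Measure Ω}
    {n p : ℕ} {X : Fin n → Ω → Fin p → ℝ} {k₀ : ℕ} {S₁ S₂ : Matrix (Fin p) (Fin p) ℝ}
    (hmod : IsChangePointModel P X k₀ S₁ S₂) : 1 ≤ p := by
  rcases Nat.eq_zero_or_pos p with h | h
  · subst h
    exact absurd (Subsingleton.elim S₁ S₂) hmod.ne
  · exact h

end CovChangePoint

theorem theorem3p3 (C₁ C₂ M : ℝ) (hC₁ : 0 < C₁) (hC₂ : 0 < C₂) (hM : 0 < M) :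
    ∃ C₀ : ℝ, 0 < C₀ ∧
      -- the exponential inequality
      (∃ c₆ : ℝ, 0 < c₆ ∧ ∀ ε : ℝ, 0 < ε → ∃ c₅ : ℝ, 0 < c₅ ∧
        ∀ (Ω : Type u) [MeasurableSpace Ω] (P : Measure Ω) [IsProbabilityMeasure P]
          (n p k₀ : ℕ) (X : Fin n → Ω → Fin p → ℝ) (S₁ S₂ : Matrix (Fin p) (Fin p) ℝ)
          (τ C : ℝ) (khat : Ω → ℕ),
          CovChangePoint.IsChangePointModel P X k₀ S₁ S₂ →
          CovChangePoint.TailAndNormBound P X S₁ S₂ C₁ C₂ M →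
          0 < τ → C₀ ≤ C →
          CovChangePoint.MinimalSignal n k₀ τ C S₁ S₂ →
          (∀ ω, CovChangePoint.IsArgmaxU (fun i => X i ω) τ (khat ω)) →
          P.real {ω | ε ≤ |(khat ω : ℝ) / (k₀ : ℝ) - 1|} ≤
            c₅ * (p : ℝ) ^ 2 * (n : ℝ) *
              (Real.exp (-c₆ * τ) + (n : ℝ) * Real.exp (-c₆ * Real.sqrt τ))) ∧
      -- consistency: convergence in probability along a triangular array
      (∀ (Ω : ℕ → Type u) [∀ ν, MeasurableSpace (Ω ν)] (P : ∀ ν, Measure (Ω ν))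
          [∀ ν, IsProbabilityMeasure (P ν)]
          (n p k₀ : ℕ → ℕ) (X : ∀ ν, Fin (n ν) → Ω ν → Fin (p ν) → ℝ)
          (S₁ S₂ : ∀ ν, Matrix (Fin (p ν)) (Fin (p ν)) ℝ)
          (τ : ℕ → ℝ) (C c : ℝ) (khat : ∀ ν, Ω ν → ℕ),
          Tendsto n atTop atTop →
          (∀ ν, CovChangePoint.IsChangePointModel (P ν) (X ν) (k₀ ν) (S₁ ν) (S₂ ν)) →
          (∀ ν, CovChangePoint.TailAndNormBound (P ν) (X ν) (S₁ ν) (S₂ ν) C₁ C₂ M) →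
          (∀ ν, 0 < τ ν) → C₀ ≤ C →
          (∀ ν, CovChangePoint.MinimalSignal (n ν) (k₀ ν) (τ ν) C (S₁ ν) (S₂ ν)) →
          0 < c → CovChangePoint.GrowthConditions n p τ c →
          (∀ ν ω, CovChangePoint.IsArgmaxU (fun i => X ν i ω) (τ ν) (khat ν ω)) →
          ∀ ε : ℝ, 0 < ε →
            Tendsto (fun ν => (P ν).real {ω | ε ≤ |(khat ν ω : ℝ) / (k₀ ν : ℝ) - 1|})
              atTop (𝓝 0)) := by
  -- The 10 lifts changed components above the threshold and 2M ensures τ ≤ n. Any positive c₆ could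
  -- be chosen; 1 is taken.
  refine ⟨10 + 2 * M, by positivity, ⟨1, one_pos, fun ε hε => ?_⟩, ?_⟩
  · obtain ⟨τ₀, A, hτ₀, hA, hmain⟩ :=
      CovChangePoint.exists_threshold_measureReal_le.{u} hC₁ hC₂ hM one_pos hε
    refine ⟨A + Real.exp τ₀, by positivity, ?_⟩
    intro Ω _ P _ n p k₀ X S₁ S₂ τ C khat hmod htail hτ hC hsig hkhat
    have hp : (1 : ℝ) ≤ p := by exact_mod_cast hmod.one_le_dim
    have hn : (1 : ℝ) ≤ n := by exact_mod_cast le_trans hmod.one_le hmod.lt.le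
    have hpn : 1 ≤ (p : ℝ) ^ 2 * n := by
      have := one_le_pow₀ hp (n := 2)
      nlinarith
    rcases le_or_gt τ₀ τ with h | h
    · refine (hmain Ω P n p k₀ X S₁ S₂ τ C khat hmod htail h hC hsig hkhat).trans ?_
      have h1 : Real.exp (-1 * √τ) ≤ Real.exp (-1 * τ) + n * Real.exp (-1 * √τ) :=
        (le_mul_of_one_le_left (Real.exp_pos _).le hn).trans
          (le_add_of_nonneg_left (Real.exp_pos _).le)
      gcongr
      linarith [Real.exp_pos τ₀]
    -- For τ < τ₀ the claimed bound exceeds 1, because c₅ ≥ exp τ₀ and p²n ≥ 1.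
    · refine (measureReal_le_one (μ := P)).trans ?_
      calc (1 : ℝ) ≤ Real.exp τ₀ * 1 * Real.exp (-1 * τ) := by
            rw [mul_one, ← Real.exp_add]
            exact Real.one_le_exp (by linarith)
        _ ≤ (A + Real.exp τ₀) * ((p : ℝ) ^ 2 * n) *
              (Real.exp (-1 * τ) + n * Real.exp (-1 * √τ)) := by
            gcongr
            · linarith
            · exact le_add_of_nonneg_right (by positivity)
        _ = _ := by ring
  · intro Ω _ P _ n p k₀ X S₁ S₂ τ C c khat hnlim hmod htail hτ hC hsig hc hgrowth hkhat ε hε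
    obtain ⟨τ₀, A, hτ₀, hA, hmain⟩ :=
      CovChangePoint.exists_threshold_measureReal_le.{u} hC₁ hC₂ hM hc hε
    obtain ⟨-, -, hlittle⟩ := hgrowth
    have hlim := (hlittle.tendsto_div_nhds_zero).const_mul A
    rw [mul_zero] at hlim
    -- Eventually n ≤ p²n² ≤ exp(c√τ), and n → ∞, so τ exceeds any bound. Taking the rate κ = c
    -- makes the deviation bound match the growth condition.
    have hlarge : ∀ᶠ ν in atTop, τ₀ ≤ τ ν := by
      have hnr : Tendsto (fun ν => (n ν : ℝ)) atTop atTop :=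
        tendsto_natCast_atTop_atTop.comp hnlim
      filter_upwards [hlittle.bound one_pos, hnr.eventually_gt_atTop (Real.exp (c * √τ₀))]
        with ν h1 h2
      have hp : (1 : ℝ) ≤ p ν := by exact_mod_cast (hmod ν).one_le_dim
      have hn : (1 : ℝ) ≤ n ν := by exact_mod_cast le_trans (hmod ν).one_le (hmod ν).lt.le
      rw [one_mul, Real.norm_of_nonneg (by positivity),
        Real.norm_of_nonneg (Real.exp_pos _).le] at h1
      have h3 : (n ν : ℝ) ≤ (p ν : ℝ) ^ 2 * (n ν : ℝ) ^ 2 := by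
        calc (n ν : ℝ) = 1 * n ν := (one_mul _).symm
          _ ≤ (p ν : ℝ) ^ 2 * (n ν : ℝ) ^ 2 :=
            mul_le_mul (one_le_pow₀ hp) (le_self_pow₀ hn (by norm_num)) (by positivity)
              (by positivity)
      have h4 := Real.exp_lt_exp.1 (h2.trans_le (h3.trans h1))
      have h5 : √τ₀ < √(τ ν) := lt_of_mul_lt_mul_left h4 hc.le
      exact ((Real.sqrt_lt_sqrt_iff hτ₀.le).1 h5).le
    refine tendsto_of_tendsto_of_tendsto_of_le_of_le' tendsto_const_nhds hlim
      (Eventually.of_forall fun ν => measureReal_nonneg) ?_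
    filter_upwards [hlarge] with ν hν
    have hn : (1 : ℝ) ≤ n ν := by exact_mod_cast le_trans (hmod ν).one_le (hmod ν).lt.le
    refine (hmain (Ω ν) (P ν) (n ν) (p ν) (k₀ ν) (X ν) (S₁ ν) (S₂ ν) (τ ν) C (khat ν) (hmod ν)
      (htail ν) hν hC (hsig ν) (hkhat ν)).trans ?_
    rw [neg_mul, Real.exp_neg, div_eq_mul_inv]
    calc A * (p ν : ℝ) ^ 2 * n ν * (Real.exp (c * √(τ ν)))⁻¹
        ≤ A * (p ν : ℝ) ^ 2 * (n ν : ℝ) ^ 2 * (Real.exp (c * √(τ ν)))⁻¹ := by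
          gcongr
          exact le_self_pow₀ hn (by norm_num)
      _ = _ := by ring
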